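/- **Definitions.** A *differential structure* on a topological space $R$ is a family $C^\infty(R)$ of real functions such that the sets $f^{-1}((a,b))$ ($f\in C^\infty(R)$, $a,b\in\mathbb R$) form a sub-basis of the topology, $F(f_1,\dots,f_n)\in C^\infty(R)$ whenever $f_i\in C^\infty(R)$ and $F\in C^\infty(\mathbb R^n)$, and every function that locally coincides with members of $C^\infty(R)$ is in $C^\infty(R)$. Subsets and products carry the induced differential structures; a map is smooth if it is continuous and pulls smooth functions back to smooth functions, and a diffeomorphism is a homeomorphism that is smooth in both directions; a smooth manifold is a differential space locally diffeomorphic to some $\mathbb R^d$. A *stratification* of a Hausdorff, second countable, paracompact space $S$ is a locally finite partition of $S$ into locally closed subsets (strata), each a smooth manifold in the induced topology, such that $M\subseteq\overline N$ whenever $M,N$ are strata with $M\cap\overline N\neq\emptyset$. A *smooth chart* is a homeomorphism $\varphi$ of an open set $U\subseteq S$ onto a subspace of some $\mathbb R^n$ such that, for each stratum $M$, $\varphi(U\cap M)$ is a smooth submanifold of $\mathbb R^n$ and $\varphi|_{U\cap M}$ is smooth. Two charts are compatible if their transition maps in both directions are locally restrictions of smooth maps between Cartesian spaces. A *smooth stratified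 space* is a stratified space with a maximal atlas of compatible smooth charts; $C^\infty(S)$ is the differential structure of all continuous functions that, near every point of every chart $\varphi$ of the atlas, have the form $g\circ\varphi$ with $g$ smooth on $\mathbb R^n$. It is *locally trivial* if every $x\in S$, lying in a stratum $M$, has an open neighbourhood $U$ for which there are a smooth stratified space $F$ with a point $o$ such that $\{o\}$ is a stratum, and a diffeomorphism $\varphi:U\to(M\cap U)\times F$ such that $\varphi(y)=(y,o)$ for $y\in M\cap U$ and $\varphi$ induces, for every stratum $N$ of $S$ meeting $U$, a diffeomorphism of the manifold $N\cap U$ onto $(M\cap U)\times P$ for some stratum $P$ of $F$. For a derivation $X$ of $C^\infty(S)$ (an $\mathbb R$-linear map satisfying Leibniz' rule), an integral curve of $X$ through $x$ is a smooth curve $c:I\to S$ on an interval $I\ni0$ with $c(0)=x$ and $\frac{d}{dt}f(c(t))=(X\cdot f)(c(t))$ for all $f\in C^\infty(S)$, $t\in I$; $\varphi^X_t(x)$ is the point with parameter $t$ on the maximal such curve. $X$ is a *vector field* if every $x\in S$ has an open neighbourhood $U$ and an $\varepsilon>0$ such that, for all $t\in(-\varepsilon,\varepsilon)$, $\varphi^X_t$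 is defined on $U$ and maps $U$ diffeomorphically onto an open subset of $S$. A vector field is *strongly stratified* if it restricts to a smooth vector field on every stratum; $\mathcal X_s(S)$ is the family of these. A family $\mathcal F$ of vector fields is *locally complete* if, for all $X,Y\in\mathcal F$, $t\in\mathbb R$ and every $x\in S$ at which the push-forward $\varphi^X_{t*}Y$ is defined (that is, $x\in V$ for some open sets $U,V$ such that $\varphi^X_t$ maps $U$ diffeomorphically onto $V$), there are an open neighbourhood $W$ of $x$ and $Z\in\mathcal F$ with $(\varphi^X_{t*}Y)|_W=Z|_W$. The *orbit* of $\mathcal F$ through $x$ is the set of all points $\varphi^{X^m}_{t_m}\circ\dots\circ\varphi^{X^1}_{t_1}(x)$ with $m\ge0$, $X^i\in\mathcal F$, $t_i\in\mathbb R$. **Theorem.** Let $S$ be a locally trivial smooth stratified space whose strata are connected. Then the family $\mathcal X_s(S)$ of strongly stratified vector fields is locally complete, and the orbits of $\mathcal X_s(S)$ are exactly the strata of $S$. -/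

import Mathlib

open Set Topology
open scoped ContDiff

universe u v

/-! ## Differential spaces -/

/-- A differential structure on the topological space `R`: a family of real functions whose
preimages of bounded open intervals are a sub-basis of the topology, closed under composition with
smooth functions of several variables, and closed under gluing.  Throughout, the Cartesian
space of dimension `n` is `Fin n → ℝ`. -/
structure DifferentialStructure (R : Type u) [τ : TopologicalSpace R] where
  /-- the family of smooth functions -/
  smooth : Set (R → ℝ)
  subbasis : τ = TopologicalSpace.generateFrom
    {s | ∃ f ∈ smooth, ∃ a b : ℝ, s = f ⁻¹' Ioo a b}
  comp_mem : ∀ (n : ℕ) (f : Fin n → R → ℝ) (F : (Fin n → ℝ) → ℝ),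
    (∀ i, f i ∈ smooth) → ContDiff ℝ ∞ F → (fun x => F fun i => f i x) ∈ smooth
  local_mem : ∀ f : R → ℝ,
    (∀ x, ∃ U : Set R, IsOpen U ∧ x ∈ U ∧ ∃ g ∈ smooth, ∀ y ∈ U, g y = f y) → f ∈ smooth

namespace DifferentialStructure

section Basic

variable {R : Type u} [τ : TopologicalSpace R]

/-- A criterion for the sub-basis condition. -/
theorem subbasis_of_bump (C : Set (R → ℝ)) (hc : ∀ f ∈ C, Continuous f)
    (hb : ∀ (x : R) (U : Set R), IsOpen U → x ∈ U →
      ∃ h ∈ C, h x = 1 ∧ ∀ y, y ∉ U → h y = 0) :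
    τ = TopologicalSpace.generateFrom {s | ∃ f ∈ C, ∃ a b : ℝ, s = f ⁻¹' Ioo a b} := by
  apply le_antisymm
  · apply le_generateFrom
    rintro s ⟨f, hf, a, b, rfl⟩
    exact isOpen_Ioo.preimage (hc f hf)
  · intro U hU
    refine (@isOpen_iff_forall_mem_open _ (TopologicalSpace.generateFrom _) U).2 fun x hx => ?_
    obtain ⟨h, hC, h1, h0⟩ := hb x U hU hx
    refine ⟨h ⁻¹' Ioo 0 2, ?_, TopologicalSpace.isOpen_generateFrom_of_mem ⟨h, hC, 0, 2, rfl⟩, ?_⟩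
    · intro y hy
      by_contra hyU
      have := h0 y hyU
      simp [this] at hy
    · simp [h1]

variable (D : DifferentialStructure R)

theorem continuous_of_mem {f : R → ℝ} (hf : f ∈ D.smooth) : Continuous f := by
  have key : ∀ a b : ℝ, IsOpen (f ⁻¹' Ioo a b) := by
    intro a b
    rw [D.subbasis]
    exact TopologicalSpace.isOpen_generateFrom_of_mem ⟨f, hf, a, b, rfl⟩
  rw [continuous_iff_continuousAt]
  intro x
  rw [ContinuousAt, Metric.tendsto_nhds]
  intro ε hε
  filter_upwards [(key (f x - ε) (f x + ε)).mem_nhds (by simp [hε])] with y hy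
  rw [Real.dist_eq, abs_lt]
  constructor <;> [linarith [hy.1]; linarith [hy.2]]

theorem comp₁_mem {f : R → ℝ} (hf : f ∈ D.smooth) {F : ℝ → ℝ} (hF : ContDiff ℝ ∞ F) :
    (fun x => F (f x)) ∈ D.smooth :=
  D.comp_mem 1 (fun _ => f) (fun v => F (v 0)) (fun _ => hf) (hF.comp (contDiff_apply ℝ ℝ 0))

theorem comp₂_mem {f g : R → ℝ} (hf : f ∈ D.smooth) (hg : g ∈ D.smooth) {F : ℝ × ℝ → ℝ}
    (hF : ContDiff ℝ ∞ F) : (fun x => F (f x, g x)) ∈ D.smooth := by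
  have := D.comp_mem 2 ![f, g] (fun v => F (v 0, v 1))
    (by intro i; fin_cases i <;> simpa) (by fun_prop)
  simpa using this

theorem mul_mem {f g : R → ℝ} (hf : f ∈ D.smooth) (hg : g ∈ D.smooth) :
    (fun x => f x * g x) ∈ D.smooth :=
  D.comp₂_mem hf hg (F := fun p => p.1 * p.2) (by fun_prop)

theorem const_mem (c : ℝ) : (fun _ => c) ∈ D.smooth :=
  D.comp_mem 0 (fun i => i.elim0) (fun _ => c) (fun i => i.elim0) contDiff_const

/-- The algebra of smooth functions of a differential space. -/
def algebra : Subalgebra ℝ (R → ℝ) where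
  carrier := D.smooth
  mul_mem' hf hg := D.mul_mem hf hg
  add_mem' hf hg := D.comp₂_mem hf hg (F := fun p => p.1 + p.2) (by fun_prop)
  algebraMap_mem' c := D.const_mem c

/-- Smooth functions that are `1` at a point and vanish off a neighbourhood of it. -/
theorem exists_bump {x : R} {U : Set R} (hU : IsOpen U) (hx : x ∈ U) :
    ∃ h ∈ D.smooth, h x = 1 ∧ ∀ y, y ∉ U → h y = 0 := by
  have hU' : TopologicalSpace.GenerateOpen
      {s | ∃ f ∈ D.smooth, ∃ a b : ℝ, s = f ⁻¹' Ioo a b} U := by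
    rw [D.subbasis] at hU
    exact hU
  induction hU' with
  | basic s hs =>
    obtain ⟨f, hf, a, b, rfl⟩ := hs
    let B : ℝ → ℝ := fun t => expNegInvGlue (t - a) * expNegInvGlue (b - t)
    have hB : ContDiff ℝ ∞ B := by
      have h1 : ContDiff ℝ ∞ expNegInvGlue := expNegInvGlue.contDiff
      exact (h1.comp (by fun_prop)).mul (h1.comp (by fun_prop))
    have hpos : 0 < B (f x) := by
      have h1 : 0 < f x - a := by linarith [hx.1]
      have h2 : 0 < b - f x := by linarith [hx.2]
      exact mul_pos (expNegInvGlue.pos_of_pos h1) (expNegInvGlue.pos_of_pos h2)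
    refine ⟨fun y => (B (f x))⁻¹ * B (f y),
      D.comp₁_mem hf (F := fun t => (B (f x))⁻¹ * B t) (contDiff_const.mul hB),
      inv_mul_cancel₀ hpos.ne', ?_⟩
    intro y hy
    have : B (f y) = 0 := by
      by_cases h : a < f y
      · have h2 : b - f y ≤ 0 := by
          by_contra h3
          exact hy ⟨h, by linarith⟩
        simp [B, expNegInvGlue.zero_of_nonpos h2]
      · have h2 : f y - a ≤ 0 := by linarith
        simp [B, expNegInvGlue.zero_of_nonpos h2]
    simp [this]
  | univ => exact ⟨fun _ => 1, D.const_mem 1, rfl, fun y hy => (hy trivial).elim⟩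
  | inter s t hs ht ihs iht =>
    obtain ⟨h, hh, h1, h0⟩ := ihs (by rw [D.subbasis]; exact hs) hx.1
    obtain ⟨k, hk, k1, k0⟩ := iht (by rw [D.subbasis]; exact ht) hx.2
    refine ⟨fun y => h y * k y, D.mul_mem hh hk, by simp [h1, k1], ?_⟩
    intro y hy
    by_cases hys : y ∈ s
    · have hyt : y ∉ t := fun hyt => hy ⟨hys, hyt⟩
      simp [k0 y hyt]
    · simp [h0 y hys]
  | sUnion S hS ih =>
    obtain ⟨s, hsS, hxs⟩ := hx
    obtain ⟨h, hh, h1, h0⟩ := ih s hsS (by rw [D.subbasis]; exact hS s hsS) hxs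
    exact ⟨h, hh, h1, fun y hy => h0 y fun hys => hy ⟨s, hsS, hys⟩⟩

/-- The differential subspace structure on a subset: the functions that are locally restrictions
of smooth functions of the ambient space. -/
def subspace (A : Set R) : DifferentialStructure A where
  smooth := {f | ∀ x : A, ∃ U : Set R, IsOpen U ∧ x.1 ∈ U ∧
    ∃ g ∈ D.smooth, ∀ y : A, y.1 ∈ U → f y = g y.1}
  subbasis := by
    apply subbasis_of_bump
    · intro f hf
      rw [continuous_iff_continuousAt]
      intro x
      obtain ⟨U, hU, hx, g, hg, hfg⟩ := hf x
      have h1 : ContinuousAt (fun y : A => g y.1) x :=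
        ((D.continuous_of_mem hg).comp continuous_subtype_val).continuousAt
      refine h1.congr ?_
      filter_upwards [(hU.preimage continuous_subtype_val).mem_nhds hx] with y hy
      exact (hfg y hy).symm
    · rintro x _ ⟨U, hU, rfl⟩ hx
      obtain ⟨h, hh, h1, h0⟩ := D.exists_bump hU hx
      exact ⟨fun y => h y.1, fun _ => ⟨univ, isOpen_univ, trivial, h, hh, fun _ _ => rfl⟩, h1,
        fun y hy => h0 y.1 hy⟩
  comp_mem := by
    intro n f F hf hF x
    choose U hU hx g hg hfg using fun i => hf i x
    refine ⟨⋂ i, U i, isOpen_iInter_of_finite hU, mem_iInter.2 hx,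
      fun y => F fun i => g i y, D.comp_mem n g F hg hF, ?_⟩
    intro y hy
    have : (fun i => f i y) = fun i => g i y.1 :=
      funext fun i => hfg i y (mem_iInter.1 hy i)
    simp [this]
  local_mem := by
    intro f hf x
    obtain ⟨_, ⟨U, hU, rfl⟩, hx, g, hg, hgf⟩ := hf x
    obtain ⟨V, hV, hxV, k, hk, hgk⟩ := hg x
    exact ⟨U ∩ V, hU.inter hV, ⟨hx, hxV⟩, k, hk, fun y hy => by
      rw [← hgf y hy.1, hgk y hy.2]⟩

/-- The restriction of a smooth function to a differential subspace. -/
def restrictFun (A : Set R) (f : D.algebra) : (D.subspace A).algebra :=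
  ⟨fun y => f.1 y.1, fun _ => ⟨univ, isOpen_univ, trivial, f.1, f.2, fun _ _ => rfl⟩⟩

/-- The differential structure of smooth functions of `n` real variables. -/
def euclidean (n : ℕ) : DifferentialStructure (Fin n → ℝ) where
  smooth := {f | ContDiff ℝ ∞ f}
  subbasis := by
    apply subbasis_of_bump
    · intro f hf
      exact ContDiff.continuous (𝕜 := ℝ) (n := ∞) hf
    · intro x U hU hx
      obtain ⟨f, hf, -, hs, -, hfx⟩ :=
        exists_contDiff_tsupport_subset (n := (⊤ : ℕ∞)) (hU.mem_nhds hx)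
      refine ⟨f, hs, hfx, ?_⟩
      intro y hy
      exact image_eq_zero_of_notMem_tsupport fun h => hy (hf h)
  comp_mem := by
    intro n f F hf hF
    exact ContDiff.comp hF (contDiff_pi.2 hf)
  local_mem := by
    intro f hf
    show ContDiff ℝ ∞ f
    refine contDiff_iff_contDiffAt.2 fun x => ?_
    obtain ⟨U, hU, hx, g, hg, hgf⟩ := hf x
    refine (ContDiff.contDiffAt (𝕜 := ℝ) (n := ∞) hg).congr_of_eventuallyEq ?_
    filter_upwards [hU.mem_nhds hx] with y hy
    exact (hgf y hy).symm

end Basic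

section Maps

variable {R : Type u} {R' : Type v} [TopologicalSpace R] [TopologicalSpace R']

/-- The product differential structure: the functions that are locally smooth functions of
finitely many smooth functions of the factors. -/
def prod (D : DifferentialStructure R) (D' : DifferentialStructure R') :
    DifferentialStructure (R × R') where
  smooth := {f | ∀ x : R × R', ∃ U : Set (R × R'), IsOpen U ∧ x ∈ U ∧
    ∃ (n m : ℕ) (a : Fin n → R → ℝ) (b : Fin m → R' → ℝ)
      (F : (Fin n → ℝ) × (Fin m → ℝ) → ℝ),
      (∀ i, a i ∈ D.smooth) ∧ (∀ j, b j ∈ D'.smooth) ∧ ContDiff ℝ ∞ F ∧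
        ∀ y ∈ U, f y = F (fun i => a i y.1, fun j => b j y.2)}
  subbasis := by
    apply subbasis_of_bump
    · intro f hf
      rw [continuous_iff_continuousAt]
      intro x
      obtain ⟨U, hU, hx, n, m, a, b, F, ha, hb, hF, hfF⟩ := hf x
      have h1 : Continuous
          (fun y : R × R' => F (fun i => a i y.1, fun j => b j y.2)) := by
        refine hF.continuous.comp (Continuous.prodMk ?_ ?_)
        · exact continuous_pi fun i => (D.continuous_of_mem (ha i)).comp continuous_fst
        · exact continuous_pi fun j => (D'.continuous_of_mem (hb j)).comp continuous_snd
      refine h1.continuousAt.congr ?_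
      filter_upwards [hU.mem_nhds hx] with y hy
      exact (hfF y hy).symm
    · intro x U hU hx
      obtain ⟨V, W, hV, hW, hxV, hxW, hVW⟩ := isOpen_prod_iff.1 hU x.1 x.2 hx
      obtain ⟨h, hh, h1, h0⟩ := D.exists_bump hV hxV
      obtain ⟨k, hk, k1, k0⟩ := D'.exists_bump hW hxW
      refine ⟨fun y => h y.1 * k y.2, ?_, by simp [h1, k1], ?_⟩
      · intro _
        refine ⟨univ, isOpen_univ, trivial, 1, 1, fun _ => h, fun _ => k,
          fun p => p.1 0 * p.2 0, fun _ => hh, fun _ => hk, by fun_prop, fun _ _ => rfl⟩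
      · intro y hy
        by_cases hyV : y.1 ∈ V
        · have hyW : y.2 ∉ W := fun hyW => hy (hVW ⟨hyV, hyW⟩)
          simp [k0 _ hyW]
        · simp [h0 _ hyV]
  comp_mem := by
    intro N f F hf hF x
    choose U hU hx n m a b G ha hb hG hfG using fun i => hf i x
    let e := Fintype.equivFin (Σ i : Fin N, Fin (n i))
    let e' := Fintype.equivFin (Σ i : Fin N, Fin (m i))
    refine ⟨⋂ i, U i, isOpen_iInter_of_finite hU, mem_iInter.2 hx, _, _,
      fun k => a (e.symm k).1 (e.symm k).2, fun k => b (e'.symm k).1 (e'.symm k).2,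
      fun p => F fun i => G i (fun j => p.1 (e ⟨i, j⟩), fun j => p.2 (e' ⟨i, j⟩)),
      fun k => ha _ _, fun k => hb _ _, ?_, ?_⟩
    · refine hF.comp (contDiff_pi.2 fun i => (hG i).comp ?_)
      fun_prop
    · intro y hy
      have : (fun i => f i y) =
          fun i => G i (fun j => a i j y.1, fun j => b i j y.2) :=
        funext fun i => hfG i y (mem_iInter.1 hy i)
      have h1 : ∀ i j, a (e.symm (e ⟨i, j⟩)).1 (e.symm (e ⟨i, j⟩)).2 y.1 = a i j y.1 :=
        fun i j => congrArg (fun q : Σ i : Fin N, Fin (n i) => a q.1 q.2 y.1)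
          (e.symm_apply_apply ⟨i, j⟩)
      have h2 : ∀ i j, b (e'.symm (e' ⟨i, j⟩)).1 (e'.symm (e' ⟨i, j⟩)).2 y.2 = b i j y.2 :=
        fun i j => congrArg (fun q : Σ i : Fin N, Fin (m i) => b q.1 q.2 y.2)
          (e'.symm_apply_apply ⟨i, j⟩)
      simp only [this, h1, h2]
  local_mem := by
    intro f hf x
    obtain ⟨U, hU, hx, g, hg, hgf⟩ := hf x
    obtain ⟨V, hV, hxV, n, m, a, b, F, ha, hb, hF, hgF⟩ := hg x
    exact ⟨U ∩ V, hU.inter hV, ⟨hx, hxV⟩, n, m, a, b, F, ha, hb, hF, fun y hy => by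
      rw [← hgf y hy.1, hgF y hy.2]⟩

/-- Smooth maps between differential spaces. -/
def IsSmooth (D : DifferentialStructure R) (D' : DifferentialStructure R') (φ : R → R') : Prop :=
  Continuous φ ∧ ∀ f ∈ D'.smooth, f ∘ φ ∈ D.smooth

/-- Diffeomorphisms between differential spaces. -/
def IsDiffeo (D : DifferentialStructure R) (D' : DifferentialStructure R') (e : R ≃ₜ R') : Prop :=
  IsSmooth D D' e ∧ IsSmooth D' D e.symm

/-- `R` is locally diffeomorphic to `R'`: every point of `R` has an open neighbourhood that is
diffeomorphic to an open subset of `R'`. -/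
def LocallyDiffeomorphicTo (D : DifferentialStructure R) (D' : DifferentialStructure R') : Prop :=
  ∀ x : R, ∃ (U : Set R) (V : Set R'), IsOpen U ∧ x ∈ U ∧ IsOpen V ∧
    ∃ e : U ≃ₜ V, IsDiffeo (D.subspace U) (D'.subspace V) e

/-- A differential space is a smooth manifold if, for some `d`, it is locally diffeomorphic to the
Cartesian space of dimension `d`. -/
def IsSmoothManifold (D : DifferentialStructure R) : Prop :=
  ∃ d : ℕ, LocallyDiffeomorphicTo D (euclidean d)

end Maps

/-! ## Derivations, vector fields, families of vector fields -/

section VectorFields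

variable {R : Type u} [TopologicalSpace R] (D : DifferentialStructure R)

/-- Derivations of the algebra of smooth functions. -/
abbrev Der : Type u := Derivation ℝ D.algebra D.algebra

variable {D}

/-- Derivations are local. -/
theorem der_congr (X : D.Der) {f g : D.algebra} {x : R} {U : Set R} (hU : IsOpen U) (hx : x ∈ U)
    (hfg : ∀ y ∈ U, f.1 y = g.1 y) : (X f).1 x = (X g).1 x := by
  obtain ⟨h, hh, h1, h0⟩ := D.exists_bump hU hx
  have hz : (⟨h, hh⟩ : D.algebra) * (f - g) = 0 := by
    ext y
    by_cases hy : y ∈ U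
    · simp [hfg y hy]
    · simp [h0 y hy]
  have h2 := X.leibniz (⟨h, hh⟩ : D.algebra) (f - g)
  rw [hz, map_zero] at h2
  have h3 := congrArg (fun k : D.algebra => k.1 x) h2
  have h4 : f.1 x - g.1 x = 0 := sub_eq_zero.2 (hfg x hx)
  simp [h1, h4] at h3
  linarith

/-- A smooth function on a differential subspace agrees near each point with a global one. -/
theorem exists_extension {U : Set R} (g : (D.subspace U).algebra) (x : U) :
    ∃ h : D.algebra, ∃ W : Set R, IsOpen W ∧ x.1 ∈ W ∧ ∀ y : U, y.1 ∈ W → g.1 y = h.1 y.1 := by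
  obtain ⟨W, hW, hx, h, hh, hgh⟩ := g.2 x
  exact ⟨⟨h, hh⟩, W, hW, hx, hgh⟩

theorem der_choose_eq (X : D.Der) {U : Set R} (hU : IsOpen U) (g : (D.subspace U).algebra) (x : U)
    (h : D.algebra) {W : Set R} (hW : IsOpen W) (hx : x.1 ∈ W)
    (hgh : ∀ y : U, y.1 ∈ W → g.1 y = h.1 y.1) :
    (X (exists_extension g x).choose).1 x.1 = (X h).1 x.1 := by
  obtain ⟨W', hW', hx', hg'⟩ := (exists_extension g x).choose_spec
  refine der_congr X ((hU.inter hW).inter hW') ⟨⟨x.2, hx⟩, hx'⟩ ?_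
  rintro y ⟨⟨hyU, hyW⟩, hyW'⟩
  rw [← hg' ⟨y, hyU⟩ hyW', hgh ⟨y, hyU⟩ hyW]

/-- The restriction of a derivation to an open subset `U`: at a point `x` of `U` it takes on `g` the
value that the derivation takes on any global smooth function that agrees with `g` near `x`. -/
noncomputable def restrictDer (X : D.Der) {U : Set R} (hU : IsOpen U) : (D.subspace U).Der :=
  Derivation.mk'
    { toFun := fun g => ⟨fun x => (X (exists_extension g x).choose).1 x.1, by
        intro x
        obtain ⟨h, W, hW, hx, hgh⟩ := exists_extension g x
        exact ⟨W, hW, hx, (X h).1, (X h).2, fun y hy => der_choose_eq X hU g y h hW hy hgh⟩⟩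
      map_add' := by
        intro g k
        ext x
        obtain ⟨h, W, hW, hx, hgh⟩ := exists_extension g x
        obtain ⟨h', W', hW', hx', hgh'⟩ := exists_extension k x
        have e1 := der_choose_eq X hU g x h hW hx hgh
        have e2 := der_choose_eq X hU k x h' hW' hx' hgh'
        have e3 := der_choose_eq X hU (g + k) x (h + h') (hW.inter hW') ⟨hx, hx'⟩
          (fun y hy => by simpa using congrArg₂ (· + ·) (hgh y hy.1) (hgh' y hy.2))
        simp only [Subalgebra.coe_add, Pi.add_apply, e3, map_add]
        exact (congrArg₂ (· + ·) e1 e2).symm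
      map_smul' := by
        intro c g
        ext x
        obtain ⟨h, W, hW, hx, hgh⟩ := exists_extension g x
        have e1 := der_choose_eq X hU g x h hW hx hgh
        have e3 := der_choose_eq X hU (c • g) x (c • h) hW hx
          (fun y hy => by simpa using congrArg (c * ·) (hgh y hy))
        have e4 : (X (c • h)).1 x.1 = c * (X h).1 x.1 := by
          rw [X.map_smul]
          rfl
        rw [← e1] at e4
        exact e3.trans e4 }
    (by
      intro g k
      ext x
      obtain ⟨h, W, hW, hx, hgh⟩ := exists_extension g x
      obtain ⟨h', W', hW', hx', hgh'⟩ := exists_extension k x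
      have e1 := der_choose_eq X hU g x h hW hx hgh
      have e2 := der_choose_eq X hU k x h' hW' hx' hgh'
      have e3 := der_choose_eq X hU (g * k) x (h * h') (hW.inter hW') ⟨hx, hx'⟩
        (fun y hy => by simpa using congrArg₂ (· * ·) (hgh y hy.1) (hgh' y hy.2))
      have e4 : (X (h * h')).1 x.1 = h.1 x.1 * (X h').1 x.1 + h'.1 x.1 * (X h).1 x.1 := by
        rw [X.leibniz]
        rfl
      rw [← hgh x hx, ← hgh' x hx', ← e1, ← e2] at e4
      exact e3.trans e4)

/-- The push-forward of a derivation by a diffeomorphism: pull back the function, differentiate, and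
transport the result by the inverse. -/
def pushforward {R' : Type v} [TopologicalSpace R'] {D' : DifferentialStructure R'} {e : R ≃ₜ R'}
    (he : IsDiffeo D D' e) (X : D.Der) : D'.Der :=
  Derivation.mk'
    { toFun := fun f =>
        ⟨(X ⟨f.1 ∘ e, he.1.2 f.1 f.2⟩).1 ∘ e.symm, he.2.2 _ (X ⟨f.1 ∘ e, he.1.2 f.1 f.2⟩).2⟩
      map_add' := by
        intro f g
        ext x
        have h := X.map_add ⟨f.1 ∘ e, he.1.2 f.1 f.2⟩ ⟨g.1 ∘ e, he.1.2 g.1 g.2⟩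
        exact congrArg (fun k : D.algebra => k.1 (e.symm x)) h
      map_smul' := by
        intro c f
        ext x
        have h := X.map_smul c ⟨f.1 ∘ e, he.1.2 f.1 f.2⟩
        exact congrArg (fun k : D.algebra => k.1 (e.symm x)) h }
    (by
      intro f g
      ext x
      have h := X.leibniz ⟨f.1 ∘ e, he.1.2 f.1 f.2⟩ ⟨g.1 ∘ e, he.1.2 g.1 g.2⟩
      have h2 := congrArg (fun k : D.algebra => k.1 (e.symm x)) h
      simp only [smul_eq_mul] at h2
      refine h2.trans ?_
      simp)

/-- `c` is an integral curve of `X` on the interval `I`.  One-sided derivatives are used at end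
points that belong to `I`.  The curve is automatically smooth on `I`, because `X f` is again a
smooth function. -/
def IsIntegralCurveOn (X : D.Der) (c : ℝ → R) (I : Set ℝ) : Prop :=
  ∀ f : D.algebra, ∀ t ∈ I, HasDerivWithinAt (fun s => f.1 (c s)) ((X f).1 (c t)) I t

/-- `y` is the point with parameter `t` on an integral curve of `X` through `x` (with parameter `0`
at `x`), that is, `y` is the image of `x` under the time `t` flow of `X`. -/
def FlowsTo (X : D.Der) (t : ℝ) (x y : R) : Prop :=
  ∃ (I : Set ℝ) (c : ℝ → R), I.OrdConnected ∧ 0 ∈ I ∧ t ∈ I ∧ IsIntegralCurveOn X c I ∧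
    c 0 = x ∧ c t = y

/-- A derivation is a vector field if its flow consists, locally and for small times, of
diffeomorphisms of an open set onto open sets. -/
def IsVectorField (X : D.Der) : Prop :=
  ∀ x : R, ∃ U : Set R, IsOpen U ∧ x ∈ U ∧ ∃ ε : ℝ, 0 < ε ∧ ∀ t ∈ Ioo (-ε) ε,
    ∃ V : Set R, IsOpen V ∧ ∃ e : U ≃ₜ V,
      IsDiffeo (D.subspace U) (D.subspace V) e ∧ ∀ y : U, FlowsTo X t y.1 (e y).1

/-- A family is locally complete if, whenever the time `t` flow of a member `X` is a diffeomorphism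
`e` of an open set `U` onto an open set `V`, then every point of `V` has an open neighbourhood on
which the push-forward by `e` of a member `Y` coincides with some member `Z`. -/
def IsLocallyComplete (ℱ : Set D.Der) : Prop :=
  ∀ X ∈ ℱ, ∀ Y ∈ ℱ, ∀ (t : ℝ) (U V : Set R) (hU : IsOpen U), IsOpen V →
    ∀ (e : U ≃ₜ V) (he : IsDiffeo (D.subspace U) (D.subspace V) e),
      (∀ y : U, FlowsTo X t y.1 (e y).1) →
        ∀ x ∈ V, ∃ (W : Set R) (hWV : W ⊆ V), IsOpen W ∧ x ∈ W ∧ ∃ Z ∈ ℱ,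
          ∀ (f : D.algebra) (p : R) (hp : p ∈ W),
            (pushforward he (restrictDer Y hU) (D.restrictFun V f)).1 ⟨p, hWV hp⟩ = (Z f).1 p

/-- The orbit through `x`: the points that can be reached from `x` by finitely many flows, for
arbitrary positive or negative times, of members of the family. -/
def orbit (ℱ : Set D.Der) (x : R) : Set R :=
  {y | Relation.ReflTransGen (fun p q => ∃ X ∈ ℱ, ∃ t : ℝ, FlowsTo X t p q) x y}

end VectorFields

end DifferentialStructure

open DifferentialStructure

/-! ## Smooth stratified spaces -/

/-- A stratification: a locally finite partition into locally closed subsets, each with the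
structure of a smooth manifold compatible with the induced topology, satisfying the frontier
condition.  Strata need not be connected. -/
structure Stratification (S : Type u) [TopologicalSpace S] where
  strata : Set (Set S)
  isPartition : Setoid.IsPartition strata
  locallyFinite : LocallyFinite (fun M : strata => M.1)
  isLocallyClosed : ∀ M ∈ strata, IsLocallyClosed M
  /-- the smooth manifold structure of a stratum -/
  manifold : ∀ M : strata, DifferentialStructure M.1
  isSmoothManifold : ∀ M : strata, (manifold M).IsSmoothManifold
  frontier : ∀ M ∈ strata, ∀ N ∈ strata, (closure N ∩ M).Nonempty → M ⊆ closure N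

/-- The open submanifold `M ∩ U` of a stratum `M`. -/
def Stratification.openPart {S : Type u} [TopologicalSpace S] (T : Stratification S)
    (M : T.strata) (U : Set S) : DifferentialStructure {p : M.1 | p.1 ∈ U} :=
  (T.manifold M).subspace {p : M.1 | p.1 ∈ U}

/-- A smooth chart on a stratified space: a homeomorphism of an open set onto a subspace of a
Cartesian space that maps the part of each stratum in the chart domain smoothly onto a smooth
submanifold.  A submanifold of a Cartesian space is a subset whose differential subspace structure
is that of a smooth manifold. -/
structure StratifiedChart {S : Type u} [TopologicalSpace S] (T : Stratification S) where
  dim : ℕ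
  source : Set S
  isOpen_source : IsOpen source
  toFun : source → (Fin dim → ℝ)
  isEmbedding : IsEmbedding toFun
  submanifold : ∀ M : T.strata,
    ((euclidean dim).subspace (toFun '' {p | p.1 ∈ M.1})).IsSmoothManifold
  smooth_restrict : ∀ M : T.strata,
    IsSmooth (T.openPart M source) (euclidean dim) (fun p => toFun ⟨p.1.1, p.2⟩)

/-- Compatibility: both transition maps are locally restrictions of smooth maps between Cartesian
spaces. -/
def StratifiedChart.Compatible {S : Type u} [TopologicalSpace S] {T : Stratification S}
    (φ ψ : StratifiedChart T) : Prop :=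
  ∀ x ∈ φ.source ∩ ψ.source, ∃ W : Set S, IsOpen W ∧ x ∈ W ∧
    (∃ g : (Fin φ.dim → ℝ) → (Fin ψ.dim → ℝ), ContDiff ℝ ∞ g ∧
      ∀ y ∈ W, ∀ (h : y ∈ φ.source) (h' : y ∈ ψ.source), ψ.toFun ⟨y, h'⟩ = g (φ.toFun ⟨y, h⟩)) ∧
    (∃ g : (Fin ψ.dim → ℝ) → (Fin φ.dim → ℝ), ContDiff ℝ ∞ g ∧
      ∀ y ∈ W, ∀ (h : y ∈ φ.source) (h' : y ∈ ψ.source), φ.toFun ⟨y, h⟩ = g (ψ.toFun ⟨y, h'⟩))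

/-- A stratification with a smooth structure, that is, a maximal atlas of compatible smooth
charts. -/
structure SmoothStratification (S : Type u) [TopologicalSpace S] extends Stratification S where
  atlas : Set (StratifiedChart toStratification)
  covers : ∀ x : S, ∃ φ ∈ atlas, x ∈ φ.source
  compatible : ∀ φ ∈ atlas, ∀ ψ ∈ atlas, φ.Compatible ψ
  maximal : ∀ φ : StratifiedChart toStratification, (∀ ψ ∈ atlas, φ.Compatible ψ) → φ ∈ atlas

namespace SmoothStratification

variable {S : Type u} [TopologicalSpace S]

/-- Smooth functions on a smooth stratified space: continuous functions that near every point of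
every chart are smooth functions of the chart coordinates. -/
def smoothFunctions (T : SmoothStratification S) : Set (S → ℝ) :=
  {f | Continuous f ∧ ∀ φ ∈ T.atlas, ∀ x ∈ φ.source, ∃ W : Set S, IsOpen W ∧ x ∈ W ∧
    ∃ hW : W ⊆ φ.source, ∃ g : (Fin φ.dim → ℝ) → ℝ, ContDiff ℝ ∞ g ∧
      ∀ (y : S) (hy : y ∈ W), f y = g (φ.toFun ⟨y, hW hy⟩)}

theorem exists_bump [T2Space S] [ParacompactSpace S] (T : SmoothStratification S) (x : S)
    (U : Set S) (hU : IsOpen U) (hx : x ∈ U) :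
    ∃ h ∈ T.smoothFunctions, h x = 1 ∧ ∀ y, y ∉ U → h y = 0 := by
  classical
  obtain ⟨φ, hφ, hxφ⟩ := T.covers x
  obtain ⟨K, hK, hKc, hKU⟩ := exists_mem_nhds_isClosed_subset
    ((hU.inter φ.isOpen_source).mem_nhds ⟨hx, hxφ⟩)
  obtain ⟨O, hO, hOK⟩ := φ.isEmbedding.isOpen_iff.1
    (isOpen_interior (s := K).preimage (continuous_subtype_val (p := (· ∈ φ.source))))
  have hxO : φ.toFun ⟨x, hxφ⟩ ∈ O := by
    have : (⟨x, hxφ⟩ : φ.source) ∈ φ.toFun ⁻¹' O := by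
      rw [hOK]
      exact mem_interior_iff_mem_nhds.2 hK
    exact this
  obtain ⟨B, hB, hBx, hB0⟩ := (euclidean φ.dim).exists_bump hO hxO
  let h : S → ℝ := fun y => if hy : y ∈ φ.source then B (φ.toFun ⟨y, hy⟩) else 0
  have hout : ∀ y, y ∉ K → h y = 0 := by
    intro y hy
    by_cases hyφ : y ∈ φ.source
    · have : φ.toFun ⟨y, hyφ⟩ ∉ O := by
        intro hyO
        have h2 : (⟨y, hyφ⟩ : φ.source) ∈ φ.toFun ⁻¹' O := hyO
        rw [hOK] at h2
        exact hy (interior_subset h2)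
      simp [h, hyφ, hB0 _ this]
    · simp [h, hyφ]
  have hin : ∀ (y : S) (hy : y ∈ φ.source), h y = B (φ.toFun ⟨y, hy⟩) := by
    intro y hy
    simp [h, hy]
  refine ⟨h, ⟨?_, ?_⟩, by rw [hin x hxφ, hBx], fun y hy => hout y fun hyK => hy (hKU hyK).1⟩
  · rw [continuous_iff_continuousAt]
    intro y
    by_cases hy : y ∈ φ.source
    · have h1 : Continuous (fun z : φ.source => h z.1) := by
        have : (fun z : φ.source => h z.1) = fun z => B (φ.toFun z) :=
          funext fun z => hin z.1 z.2
        rw [this]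
        exact (ContDiff.continuous (𝕜 := ℝ) (n := ∞) hB).comp φ.isEmbedding.continuous
      exact (continuousOn_iff_continuous_domRestrict.2 h1).continuousAt (φ.isOpen_source.mem_nhds hy)
    · have hyK : y ∉ K := fun hyK => hy (hKU hyK).2
      have h1 : ContinuousAt (fun _ : S => (0 : ℝ)) y := continuousAt_const
      refine h1.congr ?_
      filter_upwards [hKc.isOpen_compl.mem_nhds hyK] with z hz
      exact (hout z hz).symm
  · intro ψ hψ y hy
    by_cases hyφ : y ∈ φ.source
    · obtain ⟨W, hW, hyW, -, g, hg, hgW⟩ := T.compatible φ hφ ψ hψ y ⟨hyφ, hy⟩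
      refine ⟨W ∩ (φ.source ∩ ψ.source), hW.inter (φ.isOpen_source.inter ψ.isOpen_source),
        ⟨hyW, hyφ, hy⟩, fun z hz => hz.2.2, fun v => B (g v), ContDiff.comp hB hg, ?_⟩
      intro z hz
      rw [hin z hz.2.1, hgW z hz.1 hz.2.1 hz.2.2]
    · have hyK : y ∉ K := fun hyK => hyφ (hKU hyK).2
      exact ⟨Kᶜ ∩ ψ.source, hKc.isOpen_compl.inter ψ.isOpen_source, ⟨hyK, hy⟩,
        fun z hz => hz.2, fun _ => 0, contDiff_const, fun z hz => hout z hz.1⟩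

/-- The differential structure of a smooth stratified space. -/
def differentialStructure [T2Space S] [ParacompactSpace S] (T : SmoothStratification S) :
    DifferentialStructure S where
  smooth := T.smoothFunctions
  subbasis := subbasis_of_bump _ (fun _ hf => hf.1) T.exists_bump
  comp_mem := by
    intro n f F hf hF
    refine ⟨hF.continuous.comp (continuous_pi fun i => (hf i).1), ?_⟩
    intro φ hφ x hx
    choose W hW hxW hWφ g hg hfg using fun i => (hf i).2 φ hφ x hx
    refine ⟨(⋂ i, W i) ∩ φ.source, (isOpen_iInter_of_finite hW).inter φ.isOpen_source,
      ⟨mem_iInter.2 hxW, hx⟩, fun y hy => hy.2, fun v => F fun i => g i v,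
      hF.comp (contDiff_pi.2 hg), ?_⟩
    intro y hy
    have : (fun i => f i y) = fun i => g i (φ.toFun ⟨y, hy.2⟩) :=
      funext fun i => hfg i y (mem_iInter.1 hy.1 i)
    simp [this]
  local_mem := by
    intro f hf
    refine ⟨?_, ?_⟩
    · rw [continuous_iff_continuousAt]
      intro x
      obtain ⟨U, hU, hx, g, hg, hgf⟩ := hf x
      refine hg.1.continuousAt.congr ?_
      filter_upwards [hU.mem_nhds hx] with y hy
      exact hgf y hy
    · intro φ hφ x hx
      obtain ⟨U, hU, hxU, g, hg, hgf⟩ := hf x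
      obtain ⟨W, hW, hxW, hWφ, k, hk, hgk⟩ := hg.2 φ hφ x hx
      refine ⟨U ∩ W, hU.inter hW, ⟨hxU, hxW⟩, fun y hy => hWφ hy.2, k, hk, ?_⟩
      intro y hy
      rw [← hgf y hy.1, hgk y hy.2]

variable [T2Space S] [ParacompactSpace S]

/-- The restriction of a smooth function to a stratum is a smooth function on that manifold. -/
theorem restrict_mem (T : SmoothStratification S) (M : T.strata)
    (f : T.differentialStructure.algebra) :
    (fun p : M.1 => f.1 p.1) ∈ (T.manifold M).smooth := by
  apply (T.manifold M).local_mem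
  intro p
  obtain ⟨φ, hφ, hp⟩ := T.covers p.1
  obtain ⟨W, hW, hpW, hWφ, g, hg, hfg⟩ := f.2.2 φ hφ p.1 hp
  obtain ⟨U, hU, hpU, k, hk, hgk⟩ := (φ.smooth_restrict M).2 g hg ⟨p, hp⟩
  refine ⟨U ∩ Subtype.val ⁻¹' W, hU.inter (hW.preimage continuous_subtype_val), ⟨hpU, hpW⟩,
    k, hk, ?_⟩
  intro q hq
  rw [← hgk ⟨q, hWφ hq.2⟩ hq.1]
  exact (hfg q.1 hq.2).symm

/-- The restriction of a smooth function to a stratum. -/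
def restrictStratum (T : SmoothStratification S) (M : T.strata)
    (f : T.differentialStructure.algebra) : (T.manifold M).algebra :=
  ⟨fun p => f.1 p.1, T.restrict_mem M f⟩

/-- A derivation restricts to a smooth vector field on the stratum `M`, that is, to a derivation of
the algebra of smooth functions on the manifold `M`. -/
def RestrictsTo (T : SmoothStratification S) (X : T.differentialStructure.Der) (M : T.strata) :
    Prop :=
  ∃ Y : (T.manifold M).Der, ∀ f : T.differentialStructure.algebra,
    Y (T.restrictStratum M f) = T.restrictStratum M (X f)

/-- The family of strongly stratified vector fields: the vector fields that restrict to a smooth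
vector field on every stratum. -/
def stronglyStratified (T : SmoothStratification S) : Set T.differentialStructure.Der :=
  {X | IsVectorField X ∧ ∀ M : T.strata, T.RestrictsTo X M}

/-- Local triviality: every point `x`, in a stratum `M`, has an open neighbourhood `U` that is
diffeomorphic to `(M ∩ U) × F` for a smooth stratified space `F` in which a point `o` is a stratum;
the diffeomorphism sends `y` in `M ∩ U` to `(y, o)`, and it induces diffeomorphisms of the manifolds
`N ∩ U`, for the strata `N` that meet `U`, onto the manifolds `(M ∩ U) × P`, for strata `P` of
`F`. -/
def IsLocallyTrivial (T : SmoothStratification S) : Prop :=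
  ∀ (M : T.strata) (x : S), x ∈ M.1 →
    ∃ U : Set S, IsOpen U ∧ x ∈ U ∧
    ∃ (F : Type u) (_ : TopologicalSpace F) (_ : T2Space F) (_ : SecondCountableTopology F)
      (_ : ParacompactSpace F) (T' : SmoothStratification F) (o : F),
      {o} ∈ T'.strata ∧
      ∃ e : U ≃ₜ {p : M.1 | p.1 ∈ U} × F,
        IsDiffeo (T.differentialStructure.subspace U)
          ((T.openPart M U).prod T'.differentialStructure) e ∧
        (∀ (y : M.1) (hy : y.1 ∈ U), e ⟨y.1, hy⟩ = (⟨y, hy⟩, o)) ∧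
        ∀ N : T.strata, (N.1 ∩ U).Nonempty →
          ∃ (P : T'.strata) (e' : {p : N.1 | p.1 ∈ U} ≃ₜ {p : M.1 | p.1 ∈ U} × P.1),
            IsDiffeo (T.openPart N U) ((T.openPart M U).prod (T'.manifold P)) e' ∧
            ∀ (y : N.1) (hy : y.1 ∈ U),
              e ⟨y.1, hy⟩ = ((e' ⟨y, hy⟩).1, (e' ⟨y, hy⟩).2.1)

end SmoothStratification

/-! A strongly stratified field is tangent to the strata, so uniqueness of integral curves keeps
each curve in the stratum where it starts (`integralCurve_mem`); orbits therefore lie in strata.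
Conversely, a vector field on a stratum M lifts near a point to U ≅ (M ∩ U) × F with zero component
along F, and a cut-off makes the lift global; it is tangent to every stratum N because N ∩ U
corresponds to some (M ∩ U) × P (`exists_lift`). Hence orbits are open in M, and connectedness gives
all of M (`orbit_eq`). For local completeness, the push-forward by a flow of X, cut off, is again
tangent to the strata because that flow preserves each of them (`isLocallyComplete`).

The difficulty is that the derivations so built must flow by local diffeomorphisms. This is traded
for `HasUniformCurves`, the existence of integral curves of locally uniform duration, a property
that passes to open subsets, push-forwards, products and cut-off multiples (the last by
reparametrization). On a space that embeds locally in ℝⁿ it suffices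
(`HasUniformCurves.isVectorField`): a derivation is there given by a smooth field v on ℝⁿ (chain
rule, via Hadamard's lemma), its integral curves follow the flow of v
(`IsCoordsOn.exists_tracking`), and the flow maps inherit smoothness from that of v. Smooth
dependence of the latter on the initial value comes from Picard's equation, solved in a Banach space
of curves by a smooth inverse of the identity minus a contraction.

Restriction to a stratum is likewise traded for the pointwise condition `IsTangentTo`. The two agree
because local triviality makes every smooth function on a stratum locally the restriction of one on
S (`IsLocallyTrivial.isInducedOn`). -/

/-! ## Superposition operators and smooth dependence on initial values -/

section Superposition

universe w

variable {I : Type*} [TopologicalSpace I] [CompactSpace I]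
  {E F : Type w} [NormedAddCommGroup E] [NormedSpace ℝ E] [NormedAddCommGroup F] [NormedSpace ℝ F]

/-- Pointwise application of a continuous family of operators to a continuous curve. -/
noncomputable def pointwiseApply : C(I, E →L[ℝ] F) →L[ℝ] C(I, E) →L[ℝ] C(I, F) :=
  LinearMap.mkContinuous₂
    (LinearMap.mk₂ ℝ (fun (A : C(I, E →L[ℝ] F)) (α : C(I, E)) =>
        (⟨fun t => A t (α t), A.continuous.clm_apply α.continuous⟩ : C(I, F)))
      (fun _ _ _ => by ext; simp) (fun _ _ _ => by ext; simp)
      (fun _ _ _ => by ext; simp) (fun _ _ _ => by ext; simp)) 1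
    (fun A α => by
      rw [one_mul]
      refine (ContinuousMap.norm_le _ (mul_nonneg (norm_nonneg A) (norm_nonneg α))).2 fun t => ?_
      exact ((A t).le_opNorm _).trans (mul_le_mul (A.norm_coe_le_norm t) (α.norm_coe_le_norm t)
        (norm_nonneg _) (norm_nonneg _)))

/-- The mean value inequality on the segment from `α t` to `β t` bounds the remainder at each t. The
bound is uniform in t because composition with `v'` is continuous for the sup norm, I being compact.
-/
theorem hasFDerivAt_superposition (v : C(E, F)) (v' : C(E, E →L[ℝ] F))
    (h : ∀ x, HasFDerivAt v (v' x) x) (α : C(I, E)) :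
    HasFDerivAt (fun β : C(I, E) => v.comp β) (pointwiseApply (v'.comp α)) α := by
  rw [hasFDerivAt_iff_isLittleO, Asymptotics.isLittleO_iff]
  intro c hc
  have h1 : Continuous fun β : C(I, E) => v'.comp β := v'.continuous_postcomp
  obtain ⟨δ, hδ, hball⟩ := Metric.mem_nhds_iff.1
    (h1.continuousAt (x := α) (Metric.ball_mem_nhds (v'.comp α) hc))
  filter_upwards [Metric.ball_mem_nhds α hδ] with β hβ
  refine (ContinuousMap.norm_le _ (by positivity)).2 fun t => ?_
  have h2 : ‖v (β t) - v (α t) - v' (α t) (β t - α t)‖ ≤ c * ‖β t - α t‖ := by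
    refine (convex_segment (𝕜 := ℝ) (α t) (β t)).norm_image_sub_le_of_norm_hasFDerivWithin_le'
      (f' := v') (fun x _ => (h x).hasFDerivWithinAt) ?_ (left_mem_segment ℝ _ _)
      (right_mem_segment ℝ _ _)
    intro x hx
    rw [segment_eq_image'] at hx
    obtain ⟨s, hs, rfl⟩ := hx
    -- The point of the segment is the value at t of a curve in the same ball around α.
    have h3 : α + s • (β - α) ∈ Metric.ball α δ := by
      rw [Metric.mem_ball, dist_eq_norm, add_sub_cancel_left, norm_smul, Real.norm_of_nonneg hs.1]
      rw [Metric.mem_ball, dist_eq_norm] at hβ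
      exact (mul_le_of_le_one_left (norm_nonneg _) hs.2).trans_lt hβ
    have h4 : dist (v'.comp (α + s • (β - α))) (v'.comp α) < c := hball h3
    have h5 := (ContinuousMap.dist_apply_le_dist t).trans_lt h4
    rw [dist_eq_norm] at h5
    exact h5.le
  exact h2.trans (mul_le_mul_of_nonneg_left ((β - α).norm_coe_le_norm t) hc.le)

/-- The derivative is again a superposition operator, by `fderiv ℝ v`, followed by the bounded
linear `pointwiseApply`. The induction therefore has to quantify over the target space, and E and F
share a universe so that `E →L[ℝ] F` is an admissible target. -/
theorem contDiff_superposition_nat (n : ℕ) : ∀ {F : Type w} [NormedAddCommGroup F]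
    [NormedSpace ℝ F] (v : C(E, F)), ContDiff ℝ n v →
      ContDiff ℝ n (fun β : C(I, E) => v.comp β) := by
  induction n with
  | zero =>
    intro F _ _ v _
    exact contDiff_zero.2 v.continuous_postcomp
  | succ n ih =>
    intro F _ _ v hv
    have h1 : ContDiff ℝ (n + 1) v := by exact_mod_cast hv
    rw [contDiff_succ_iff_fderiv] at h1
    have hd : ∀ x, HasFDerivAt v (fderiv ℝ v x) x := fun x => (h1.1 x).hasFDerivAt
    have key := contDiff_succ_iff_hasFDerivAt (n := n) (f := fun β : C(I, E) => v.comp β) (𝕜 := ℝ)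
    refine key.2 ⟨_, ?_, fun α => hasFDerivAt_superposition v
      ⟨fderiv ℝ v, h1.2.2.continuous⟩ hd α⟩
    exact pointwiseApply.contDiff.comp (ih ⟨fderiv ℝ v, h1.2.2.continuous⟩ h1.2.2)

theorem contDiff_superposition (v : C(E, F)) (hv : ContDiff ℝ ∞ v) :
    ContDiff ℝ ∞ (fun β : C(I, E) => v.comp β) :=
  contDiff_infty.2 fun n => contDiff_superposition_nat n v (hv.of_le (by exact_mod_cast le_top))

end Superposition

/-! ### Smooth dependence of short-time flows on the initial value. -/

section Flow

universe w

variable {E : Type w} [NormedAddCommGroup E] [NormedSpace ℝ E]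

/-- The primitive vanishing at `0` of a continuous curve on `[-1, 1]`, as a linear map. -/
noncomputable def primitiveLinear : C(Icc (-1 : ℝ) 1, E) →ₗ[ℝ] C(Icc (-1 : ℝ) 1, E) :=
  -- `projIcc` prolongs the curve by its end values, so the integrand is continuous on all of ℝ.
  have hcont : ∀ α : C(Icc (-1 : ℝ) 1, E),
      Continuous fun s => α (projIcc (-1) 1 (by norm_num) s) :=
    fun α => α.continuous.comp continuous_projIcc
  { toFun := fun α => ⟨fun t => ∫ s in (0 : ℝ)..t, α (projIcc (-1) 1 (by norm_num) s),
      (intervalIntegral.continuous_primitive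
        (fun _ _ => (hcont α).intervalIntegrable _ _) 0).comp continuous_subtype_val⟩
    map_add' := fun α β => by
      ext t
      exact intervalIntegral.integral_add ((hcont α).intervalIntegrable _ _)
        ((hcont β).intervalIntegrable _ _)
    map_smul' := fun c α => by
      ext t
      exact intervalIntegral.integral_smul c _ }

theorem norm_primitiveLinear_le (α : C(Icc (-1 : ℝ) 1, E)) : ‖primitiveLinear α‖ ≤ ‖α‖ := by
  refine (ContinuousMap.norm_le _ (norm_nonneg _)).2 fun t => ?_
  refine (intervalIntegral.norm_integral_le_of_norm_le_const
    (fun s _ => α.norm_coe_le_norm _)).trans (mul_le_of_le_one_right (norm_nonneg _) ?_)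
  rw [sub_zero]
  exact abs_le.2 t.2

/-- The primitive vanishing at `0` of a continuous curve on `[-1, 1]`. -/
noncomputable def primitive : C(Icc (-1 : ℝ) 1, E) →L[ℝ] C(Icc (-1 : ℝ) 1, E) :=
  primitiveLinear.mkContinuous 1 fun α => (norm_primitiveLinear_le α).trans (one_mul _).ge

theorem primitive_apply (α : C(Icc (-1 : ℝ) 1, E)) (t : Icc (-1 : ℝ) 1) :
    primitive α t = ∫ s in (0 : ℝ)..t, α (projIcc (-1) 1 (by norm_num) s) := rfl

theorem norm_primitive_apply_le (α : C(Icc (-1 : ℝ) 1, E)) : ‖primitive α‖ ≤ ‖α‖ :=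
  norm_primitiveLinear_le α

/-- A perturbation of the identity by a smooth map with Lipschitz constant `1 / 2` has a smooth
inverse. -/
theorem exists_smooth_inverse_id_sub {Z : Type*} [NormedAddCommGroup Z] [NormedSpace ℝ Z]
    [CompleteSpace Z] {P : Z → Z} (hP : ContDiff ℝ ∞ P) (hL : LipschitzWith (1 / 2) P) :
    ∃ H : Z → Z, ContDiff ℝ ∞ H ∧ ∀ z, H z - P (H z) = z := by
  -- Being within Lipschitz distance 1/2 < 1 of the identity, id - P is a homeomorphism of Z.
  have happrox : ApproximatesLinearOn (fun z => z - P z)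
      ((ContinuousLinearEquiv.refl ℝ Z : Z ≃L[ℝ] Z) : Z →L[ℝ] Z) univ (1 / 2) := by
    intro x _ y _
    have h1 := hL.norm_sub_le y x
    have e1 : x - P x - (y - P y) - (x - y) = P y - P x := by abel
    simpa [e1, norm_sub_rev] using h1
  have hc : Subsingleton Z ∨ (1 / 2 : NNReal) <
      ‖(((ContinuousLinearEquiv.refl ℝ Z).symm : Z ≃L[ℝ] Z) : Z →L[ℝ] Z)‖₊⁻¹ := by
    rcases subsingleton_or_nontrivial Z with h | h
    · exact Or.inl h
    · right
      have : ‖(((ContinuousLinearEquiv.refl ℝ Z).symm : Z ≃L[ℝ] Z) : Z →L[ℝ] Z)‖₊ = 1 :=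
        NNReal.eq ContinuousLinearMap.norm_id
      rw [this, inv_one]
      norm_num
  let e := happrox.toHomeomorph _ hc
  have hnorm : ∀ z, ‖fderiv ℝ P z‖ < 1 := fun z =>
    (norm_fderiv_le_of_lipschitz ℝ hL).trans_lt (by norm_num)
  -- The derivative 1 - P' is invertible by the Neumann series; hence the inverse homeomorphism is
  -- smooth.
  have hder : ∀ z, HasFDerivAt e ((ContinuousLinearEquiv.ofUnit (Units.oneSub _ (hnorm z)) :
      Z ≃L[ℝ] Z) : Z →L[ℝ] Z) z := fun z =>
    (hasFDerivAt_id z).sub (hP.differentiable (by simp) z).hasFDerivAt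
  exact ⟨e.symm, e.contDiff_symm hder (contDiff_id.sub hP), e.apply_symm_apply⟩

/-- Short-time flows of smooth Lipschitz vector fields exist and are smooth in the initial value. -/
theorem exists_smooth_flow [CompleteSpace E] {v : E → E} (hv : ContDiff ℝ ∞ v) {K : NNReal}
    (hK : LipschitzWith K v) :
    ∃ ε : ℝ, 0 < ε ∧ ∃ θ : ℝ → E → E, (∀ t, ContDiff ℝ ∞ (θ t)) ∧ (∀ x, θ 0 x = x) ∧
      ∀ x, ∀ t ∈ Ioo (-ε) ε, HasDerivAt (fun s => θ s x) (v (θ t x)) t := by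
  -- Time is rescaled by ε so that curves live on [-1, 1]. The Picard operator then has Lipschitz
  -- constant at most εK ≤ 1/2; the summand 1 covers K = 0.
  set ε : ℝ := (2 * (K + 1))⁻¹ with hε
  have hεpos : 0 < ε := by positivity
  have hεK : ε * K ≤ 1 / 2 := by
    rw [hε, inv_mul_le_iff₀ (by positivity)]
    linarith
  let V : C(E, E) := ⟨v, hv.continuous⟩
  let P : C(Icc (-1 : ℝ) 1, E) → C(Icc (-1 : ℝ) 1, E) := fun α => ε • primitive (V.comp α)
  have hP : ContDiff ℝ ∞ P :=
    (primitive.contDiff.comp (contDiff_superposition V hv)).const_smul ε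
  have hL : LipschitzWith (1 / 2) P := by
    refine LipschitzWith.of_dist_le_mul fun α β => ?_
    have h1 : ‖V.comp α - V.comp β‖ ≤ K * ‖α - β‖ := by
      refine (ContinuousMap.norm_le _ (by positivity)).2 fun t => ?_
      exact (hK.norm_sub_le (α t) (β t)).trans
        (mul_le_mul_of_nonneg_left ((α - β).norm_coe_le_norm t) K.2)
    have h2 := norm_primitive_apply_le (V.comp α - V.comp β)
    have e1 : P α - P β = ε • primitive (V.comp α - V.comp β) := by
      simp only [P, map_sub, smul_sub]
    rw [dist_eq_norm, dist_eq_norm, e1, norm_smul, Real.norm_of_nonneg hεpos.le]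
    calc ε * ‖primitive (V.comp α - V.comp β)‖ ≤ ε * (K * ‖α - β‖) :=
          mul_le_mul_of_nonneg_left (h2.trans h1) hεpos.le
      _ = (ε * K) * ‖α - β‖ := by ring
      _ ≤ _ := mul_le_mul_of_nonneg_right hεK (norm_nonneg _)
  -- Picard's equation reads α - P α = const x. Its solution H (const x) depends smoothly on x
  -- because H is smooth and x ↦ const x is linear and bounded.
  obtain ⟨H, hH, hHP⟩ := exists_smooth_inverse_id_sub hP hL
  have hfix : ∀ x, H (ContinuousMap.const _ x) = ContinuousMap.const _ x +
      ε • primitive (V.comp (H (ContinuousMap.const _ x))) := by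
    intro x
    rw [← sub_eq_iff_eq_add]
    exact hHP (ContinuousMap.const _ x)
  let θ : ℝ → E → E := fun t x =>
    H (ContinuousMap.const _ x) (projIcc (-1) 1 (by norm_num) (t / ε))
  have hconst : ContDiff ℝ ∞ fun x : E => ContinuousMap.const (Icc (-1 : ℝ) 1) x := by
    have : (fun x : E => ContinuousMap.const (Icc (-1 : ℝ) 1) x) =
        (LinearMap.mkContinuous
          { toFun := fun x : E => ContinuousMap.const (Icc (-1 : ℝ) 1) x
            map_add' := fun _ _ => rfl
            map_smul' := fun _ _ => rfl } 1 (fun x => by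
              rw [one_mul]
              exact (ContinuousMap.norm_le _ (norm_nonneg _)).2 fun _ => le_rfl) :
          E →L[ℝ] C(Icc (-1 : ℝ) 1, E)) := rfl
    rw [this]
    exact ContinuousLinearMap.contDiff _
  have hθ : ∀ x, ∀ t ∈ Ioo (-ε) ε, θ t x = x + ε • ∫ s in (0 : ℝ)..(t / ε), v (θ (ε * s) x) := by
    intro x t ht
    have ht' : t / ε ∈ Icc (-1 : ℝ) 1 := by
      rw [mem_Icc, le_div_iff₀ hεpos, div_le_iff₀ hεpos]
      constructor <;> linarith [ht.1, ht.2]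
    have h1 := congrArg (fun α : C(Icc (-1 : ℝ) 1, E) => α (projIcc (-1) 1 (by norm_num) (t / ε)))
      (hfix x)
    simp only [ContinuousMap.add_apply, ContinuousMap.smul_apply, primitive_apply,
      ContinuousMap.const_apply] at h1
    rw [show θ t x = _ from h1, projIcc_of_mem _ ht']
    congr 2
    refine intervalIntegral.integral_congr fun s _ => ?_
    simp only [θ, mul_div_cancel_left₀ s hεpos.ne']
    rfl
  have hθcont : ∀ x, Continuous fun s => θ s x := fun x =>
    (H (ContinuousMap.const _ x)).continuous.comp
      (continuous_projIcc.comp (continuous_id.div_const ε))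
  refine ⟨ε, hεpos, θ, ?_, ?_, ?_⟩
  · intro t
    exact (ContinuousMap.evalCLM ℝ
      (projIcc (-1 : ℝ) 1 (by norm_num) (t / ε))).contDiff.comp (hH.comp hconst)
  · intro x
    rw [hθ x 0 (by simp [hεpos])]
    simp
  · intro x t ht
    have h0 : Continuous fun s => v (θ (ε * s) x) :=
      hv.continuous.comp ((hθcont x).comp (continuous_const.mul continuous_id))
    have h1 : HasDerivAt (fun s => ∫ r in (0 : ℝ)..s, v (θ (ε * r) x)) (v (θ (ε * (t / ε)) x))
        (t / ε) := (h0.integral_hasStrictDerivAt 0 _).hasDerivAt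
    have h2 := (((h1.scomp t ((hasDerivAt_id t).div_const ε)).const_smul ε).const_add x)
    rw [mul_div_cancel₀ _ hεpos.ne', smul_smul, mul_one_div_cancel hεpos.ne', one_smul] at h2
    refine h2.congr_of_eventuallyEq ?_
    filter_upwards [isOpen_Ioo.mem_nhds ht] with s hs
    exact hθ x s hs

end Flow

/-- Hadamard's lemma. -/
theorem exists_hadamard {n : ℕ} {g : (Fin n → ℝ) → ℝ} (hg : ContDiff ℝ ∞ g) (a : Fin n → ℝ) :
    ∃ h : Fin n → (Fin n → ℝ) → ℝ, (∀ i, ContDiff ℝ ∞ (h i)) ∧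
      (∀ x, g x = g a + ∑ i, (x i - a i) * h i x) ∧
      ∀ i, h i a = fderiv ℝ g a (Pi.single i 1) := by
  -- The coefficient hᵢ(x) is the integral over [0, 1] of ∂ᵢg along the segment from a to x. Its
  -- smoothness needs no differentiation under the integral sign: it is an affine map into curves,
  -- then a superposition operator, then a primitive, then evaluation at 1.
  let γ : (Fin n → ℝ) → C(Icc (-1 : ℝ) 1, Fin n → ℝ) := fun x =>
    ⟨fun s => a + (s : ℝ) • (x - a), by fun_prop⟩
  have hγ : ContDiff ℝ ∞ γ := by
    let A : (Fin n → ℝ) →L[ℝ] C(Icc (-1 : ℝ) 1, Fin n → ℝ) := LinearMap.mkContinuous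
          { toFun := fun x => ⟨fun s => (s : ℝ) • x, by fun_prop⟩
            map_add' := fun _ _ => by ext; simp
            map_smul' := fun _ _ => by ext; simp; ring } 1 (fun x => by
              rw [one_mul]
              refine (ContinuousMap.norm_le _ (norm_nonneg _)).2 fun s => ?_
              refine (norm_smul_le _ _).trans (mul_le_of_le_one_left (norm_nonneg _) ?_)
              exact abs_le.2 s.2)
    have : γ = fun x => ContinuousMap.const _ a + A (x - a) := rfl
    rw [this]
    exact contDiff_const.add (A.contDiff.comp (contDiff_id.sub contDiff_const))
  let V : Fin n → C(Fin n → ℝ, ℝ) := fun i =>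
    ⟨fun x => fderiv ℝ g x (Pi.single i 1),
      (hg.continuous_fderiv (by simp)).clm_apply continuous_const⟩
  have hV : ∀ i, ContDiff ℝ ∞ (V i) := fun i =>
    (hg.fderiv_right (m := ∞) (by simp)).clm_apply contDiff_const
  let one : Icc (-1 : ℝ) 1 := ⟨1, by norm_num⟩
  have hval : ∀ i x, primitive ((V i).comp (γ x)) one =
      ∫ s in (0 : ℝ)..1, fderiv ℝ g (a + s • (x - a)) (Pi.single i 1) := by
    intro i x
    rw [primitive_apply]
    refine intervalIntegral.integral_congr fun s hs => ?_
    rw [uIcc_of_le zero_le_one] at hs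
    have : s ∈ Icc (-1 : ℝ) 1 := ⟨by linarith [hs.1], hs.2⟩
    simp only [projIcc_of_mem _ this]
    rfl
  refine ⟨fun i x => primitive ((V i).comp (γ x)) one, ?_, ?_, ?_⟩
  · intro i
    exact (ContinuousMap.evalCLM ℝ one).contDiff.comp
      (primitive.contDiff.comp ((contDiff_superposition (V i) (hV i)).comp hγ))
  · intro x
    have hd : ∀ s ∈ uIcc (0 : ℝ) 1, HasDerivAt (fun s : ℝ => g (a + s • (x - a)))
        (fderiv ℝ g (a + s • (x - a)) (x - a)) s := by
      intro s _
      have h1 : HasDerivAt (fun s : ℝ => a + s • (x - a)) (x - a) s := by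
        simpa using ((hasDerivAt_id s).smul_const (x - a)).const_add a
      exact ((hg.differentiable (by simp) _).hasFDerivAt).comp_hasDerivAt s h1
    have hc : ∀ w, Continuous fun s : ℝ => fderiv ℝ g (a + s • (x - a)) w := fun w =>
      ((hg.continuous_fderiv (by simp)).comp (by fun_prop)).clm_apply continuous_const
    have h2 := intervalIntegral.integral_eq_sub_of_hasDerivAt hd ((hc _).intervalIntegrable _ _)
    have h3 : ∀ s : ℝ, fderiv ℝ g (a + s • (x - a)) (x - a) =
        ∑ i, (x i - a i) * fderiv ℝ g (a + s • (x - a)) (Pi.single i 1) := by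
      intro s
      have h4 : x - a = ∑ i, (x i - a i) • (Pi.single i 1 : Fin n → ℝ) := by
        ext j
        simp [Finset.sum_apply, Pi.single_apply]
      calc _ = fderiv ℝ g (a + s • (x - a)) (∑ i, (x i - a i) • (Pi.single i 1 : Fin n → ℝ)) := by
            rw [← h4]
        _ = _ := by simp only [map_sum, map_smul, smul_eq_mul]
    simp only [h3] at h2
    rw [intervalIntegral.integral_finsetSum
      (fun i _ => ((hc _).const_mul _).intervalIntegrable _ _)] at h2
    simp only [intervalIntegral.integral_const_mul] at h2
    simp only [hval]
    rw [h2]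
    simp
  · intro i
    simp only [hval]
    simp

/-! ## Connectedness and uniqueness for ordinary differential equations -/

/-- The set where P holds is clopen in s. This form of connectedness serves for uniqueness of
curves, for tracking, for invariance of strata and for orbits. -/
theorem IsPreconnected.forall_of_eventually {α : Type*} [TopologicalSpace α] {s : Set α}
    (hs : IsPreconnected s) {P : α → Prop} {x₀ : α} (hx₀ : x₀ ∈ s) (h₀ : P x₀)
    (h1 : ∀ x ∈ s, P x → ∀ᶠ y in 𝓝[s] x, P y)
    (h2 : ∀ x ∈ s, ¬ P x → ∀ᶠ y in 𝓝[s] x, ¬ P y) : ∀ x ∈ s, P x := by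
  have : PreconnectedSpace s := isPreconnected_iff_preconnectedSpace.1 hs
  have hclopen : IsClopen {x : s | P x.1} := by
    refine ⟨⟨isOpen_iff_mem_nhds.2 fun x hx => ?_⟩, isOpen_iff_mem_nhds.2 fun x hx => ?_⟩
    · exact (eventually_nhds_subtype_iff s x fun y => ¬ P y).2 (h2 x.1 x.2 hx)
    · exact (eventually_nhds_subtype_iff s x P).2 (h1 x.1 x.2 hx)
  have huniv := hclopen.eq_univ ⟨⟨x₀, hx₀⟩, h₀⟩
  intro x hx
  exact (huniv ▸ mem_univ (⟨x, hx⟩ : s) : (⟨x, hx⟩ : s) ∈ {x : s | P x.1})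

/-- Grönwall uniqueness on the compact interval between `t₀` and s, forwards or backwards.
Derivatives within J suffice, so J may contain its end points. -/
theorem ode_unique_of_ordConnected {E : Type*} [NormedAddCommGroup E] [NormedSpace ℝ E]
    {v : E → E} {K : NNReal} (hv : LipschitzWith K v) {J : Set ℝ} (hJ : J.OrdConnected)
    {f g : ℝ → E} (hf : ∀ t ∈ J, HasDerivWithinAt f (v (f t)) J t)
    (hg : ∀ t ∈ J, HasDerivWithinAt g (v (g t)) J t) {t₀ : ℝ} (ht₀ : t₀ ∈ J)
    (h : f t₀ = g t₀) : EqOn f g J := by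
  intro s hs
  have hcf : ContinuousOn f J := fun t ht => (hf t ht).continuousWithinAt
  have hcg : ContinuousOn g J := fun t ht => (hg t ht).continuousWithinAt
  rcases le_total t₀ s with hle | hle
  · have hsub : Icc t₀ s ⊆ J := hJ.out ht₀ hs
    have key : ∀ k : ℝ → E, (∀ t ∈ J, HasDerivWithinAt k (v (k t)) J t) →
        ∀ t ∈ Ico t₀ s, HasDerivWithinAt k (v (k t)) (Ici t) t := fun k hk t ht =>
      ((hk t (hsub (Ico_subset_Icc_self ht))).mono
        ((Icc_subset_Icc_left ht.1).trans hsub)).mono_of_mem_nhdsWithin (Icc_mem_nhdsGE ht.2)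
    exact ODE_solution_unique (v := fun _ => v) (fun _ => hv) (hcf.mono hsub) (key f hf)
      (hcg.mono hsub) (key g hg) h ⟨hle, le_rfl⟩
  · have hsub : Icc s t₀ ⊆ J := hJ.out hs ht₀
    have key : ∀ k : ℝ → E, (∀ t ∈ J, HasDerivWithinAt k (v (k t)) J t) →
        ∀ t ∈ Ioc s t₀, HasDerivWithinAt k (v (k t)) (Iic t) t := fun k hk t ht =>
      ((hk t (hsub (Ioc_subset_Icc_self ht))).mono
        ((Icc_subset_Icc_right ht.2).trans hsub)).mono_of_mem_nhdsWithin (Icc_mem_nhdsLE ht.1)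
    exact ODE_solution_unique_of_mem_Icc_left (v := fun _ => v) (s := fun _ => univ)
      (fun _ _ => hv.lipschitzOnWith) (hcf.mono hsub) (key f hf) (fun _ _ => trivial)
      (hcg.mono hsub) (key g hg) (fun _ _ => trivial) h ⟨le_rfl, hle⟩

/-- The short-time flow of a smooth compactly supported vector field. -/
theorem exists_flow_of_hasCompactSupport {E : Type*} [NormedAddCommGroup E] [NormedSpace ℝ E]
    [CompleteSpace E] {v : E → E} (hv : ContDiff ℝ ∞ v) (hc : HasCompactSupport v) {r : ℝ}
    (hr : 0 < r) :
    ∃ ε : ℝ, 0 < ε ∧ ∃ θ : ℝ → E → E, (∀ t, ContDiff ℝ ∞ (θ t)) ∧ (∀ x, θ 0 x = x) ∧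
      (∀ x, ∀ t ∈ Ioo (-ε) ε, HasDerivAt (fun s => θ s x) (v (θ t x)) t) ∧
      (∀ x, ∀ t ∈ Ioo (-ε) ε, dist (θ t x) x < r) ∧
      ∀ x, ∀ t ∈ Ioo (-ε) ε, θ (-t) (θ t x) = x := by
  obtain ⟨K, hK⟩ := (hv.of_le (m := 1) (by simp)).lipschitzWith_of_hasCompactSupport hc (by simp)
  obtain ⟨C, hC⟩ := hc.exists_bound_of_continuous hv.continuous
  obtain ⟨ε, hε, θ, hθ, hθ0, hder⟩ := exists_smooth_flow hv hK
  have hC0 : 0 ≤ C := (norm_nonneg _).trans (hC 0)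
  -- The speed is at most C, so the displacement in time r / (C + 1) stays below r.
  set ε' : ℝ := min ε (r / (C + 1)) with hε'
  have hsub : Ioo (-ε') ε' ⊆ Ioo (-ε) ε :=
    Ioo_subset_Ioo (neg_le_neg (min_le_left _ _)) (min_le_left _ _)
  have hder' : ∀ x, ∀ t ∈ Ioo (-ε') ε', HasDerivAt (fun s => θ s x) (v (θ t x)) t :=
    fun x t ht => hder x t (hsub ht)
  have hε'pos : 0 < ε' := lt_min hε (by positivity)
  have h0 : (0 : ℝ) ∈ Ioo (-ε') ε' := ⟨by linarith, hε'pos⟩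
  refine ⟨ε', hε'pos, θ, hθ, hθ0, hder', ?_, ?_⟩
  · intro x t ht
    have h1 := (convex_Ioo (-ε') ε').norm_image_sub_le_of_norm_hasDerivWithin_le
      (fun s hs => (hder' x s hs).hasDerivWithinAt) (fun s _ => hC (θ s x)) h0 ht
    rw [hθ0, sub_zero] at h1
    rw [dist_eq_norm]
    have h2 : ‖t‖ < r / (C + 1) := (abs_lt.2 ht).trans_le (min_le_right _ _)
    rw [lt_div_iff₀ (by positivity)] at h2
    nlinarith [norm_nonneg t]
  · intro x t ht
    -- Group law by uniqueness: s ↦ θ s (θ t x) and s ↦ θ (s + t) x solve the same equation for s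
    -- between 0 and -t, where s + t stays between t and 0.
    have hJ : (Icc (min 0 (-t)) (max 0 (-t))).OrdConnected := ordConnected_Icc
    have hmem : ∀ s ∈ Icc (min 0 (-t)) (max 0 (-t)), s ∈ Ioo (-ε') ε' ∧ s + t ∈ Ioo (-ε') ε' := by
      intro s hs
      rcases le_total t 0 with h | h
      · rw [min_eq_left (by linarith), max_eq_right (by linarith)] at hs
        exact ⟨⟨by linarith [hs.1], by linarith [hs.2, ht.1]⟩,
          ⟨by linarith [hs.1, ht.1], by linarith [hs.2]⟩⟩
      · rw [min_eq_right (by linarith), max_eq_left (by linarith)] at hs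
        exact ⟨⟨by linarith [hs.1, ht.2], by linarith [hs.2]⟩,
          ⟨by linarith [hs.1, ht.1], by linarith [hs.2, ht.2]⟩⟩
    have h1 := ode_unique_of_ordConnected hK hJ (f := fun s => θ s (θ t x))
      (g := fun s => θ (s + t) x) (fun s hs => (hder' _ s (hmem s hs).1).hasDerivWithinAt)
      (fun s hs => ((hder' x _ (hmem s hs).2).comp_add_const s t).hasDerivWithinAt)
      (t₀ := 0) ⟨min_le_left _ _, le_max_left _ _⟩ (by simp [hθ0])
    have h2 := h1 (x := -t) ⟨min_le_right _ _, le_max_right _ _⟩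
    simpa [hθ0] using h2

namespace DifferentialStructure

/-! ## Calculus of derivations -/

section Derivations

variable {R : Type u} [TopologicalSpace R] {D : DifferentialStructure R}

theorem der_mul_apply (X : D.Der) (f g : D.algebra) (x : R) :
    (X (f * g)).1 x = f.1 x * (X g).1 x + g.1 x * (X f).1 x := by
  rw [X.leibniz]
  rfl

theorem der_add_apply (X : D.Der) (f g : D.algebra) (x : R) :
    (X (f + g)).1 x = (X f).1 x + (X g).1 x := by
  rw [X.map_add]
  rfl

theorem der_smul_apply (X : D.Der) (c : ℝ) (f : D.algebra) (x : R) :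
    (X (c • f)).1 x = c * (X f).1 x := by
  rw [X.map_smul]
  rfl

theorem eq_of_apply_eq {f g : D.algebra} (h : ∀ x, f.1 x = g.1 x) : f = g :=
  Subtype.ext (funext h)

/-- A derivation from pointwise data. -/
def derOfPointwise (L : D.algebra → R → ℝ) (hL : ∀ f, L f ∈ D.smooth)
    (hadd : ∀ f g x, L (f + g) x = L f x + L g x) (hsmul : ∀ (c : ℝ) f x, L (c • f) x = c * L f x)
    (hmul : ∀ f g x, L (f * g) x = f.1 x * L g x + g.1 x * L f x) : D.Der :=
  Derivation.mk'
    { toFun := fun f => ⟨L f, hL f⟩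
      map_add' := fun f g => eq_of_apply_eq (hadd f g)
      map_smul' := fun c f => eq_of_apply_eq (hsmul c f) }
    (fun f g => eq_of_apply_eq (hmul f g))

/-- The map into a Cartesian space with given smooth components. -/
def coordMap {n : ℕ} (φ : Fin n → D.algebra) (x : R) : Fin n → ℝ := fun i => (φ i).1 x

theorem continuous_coordMap {n : ℕ} (φ : Fin n → D.algebra) : Continuous (coordMap φ) :=
  continuous_pi fun i => D.continuous_of_mem (φ i).2

/-- The velocity of the coordinates along a derivation. -/
def coordVel {n : ℕ} (X : D.Der) (φ : Fin n → D.algebra) (x : R) : Fin n → ℝ :=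
  fun i => (X (φ i)).1 x

/-- The chain rule for derivations. -/
theorem der_comp_apply (X : D.Der) {n : ℕ} (φ : Fin n → D.algebra) {g : (Fin n → ℝ) → ℝ}
    (hg : ContDiff ℝ ∞ g) {f : D.algebra} {y : R} {W : Set R} (hW : IsOpen W) (hy : y ∈ W)
    (hf : ∀ z ∈ W, f.1 z = g (coordMap φ z)) :
    (X f).1 y = fderiv ℝ g (coordMap φ y) (coordVel X φ y) := by
  -- Expand g at the image of y. A derivation kills the constant term, and in each product the
  -- factor φᵢ - φᵢ(y) vanishes at y, so that Leibniz' rule leaves only X φᵢ times ∂ᵢg.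
  obtain ⟨h, hh, hgh, hha⟩ := exists_hadamard hg (coordMap φ y)
  let H : Fin n → D.algebra := fun i =>
    ⟨fun z => h i (coordMap φ z), D.comp_mem n (fun j => (φ j).1) (h i) (fun j => (φ j).2) (hh i)⟩
  let c : ℝ → D.algebra := algebraMap ℝ D.algebra
  have hc : ∀ a z, (c a).1 z = a := fun _ _ => rfl
  have hsum : ∀ (s : Finset (Fin n)) (F : Fin n → D.algebra) z,
      (∑ i ∈ s, F i).1 z = ∑ i ∈ s, (F i).1 z := by
    intro s F z
    rw [AddSubmonoidClass.coe_finsetSum, Finset.sum_apply]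
  have h1 : (X f).1 y = (X (c (g (coordMap φ y)) +
      ∑ i, (φ i - c (coordMap φ y i)) * H i)).1 y := by
    refine der_congr X hW hy fun z hz => ?_
    rw [hf z hz, hgh]
    have := hsum Finset.univ (fun i => (φ i - c (coordMap φ y i)) * H i) z
    exact (congrArg (g (coordMap φ y) + ·) this).symm
  have h2 : ∀ i, (X ((φ i - c (coordMap φ y i)) * H i)).1 y =
      coordVel X φ y i * h i (coordMap φ y) := by
    intro i
    have e1 : (φ i - c (coordMap φ y i)).1 y = 0 := sub_self _
    have e2 : X (φ i - c (coordMap φ y i)) = X (φ i) := by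
      rw [map_sub, X.map_algebraMap, sub_zero]
    rw [der_mul_apply, e1, e2, zero_mul, zero_add, mul_comm]
    rfl
  rw [h1, der_add_apply, X.map_algebraMap, map_sum, hsum]
  simp only [h2, hha]
  have h4 : coordVel X φ y = ∑ i, coordVel X φ y i • (Pi.single i 1 : Fin n → ℝ) := by
    ext j
    simp [Finset.sum_apply, Pi.single_apply]
  conv_rhs => rw [h4]
  simp only [map_sum, map_smul, smul_eq_mul]
  exact zero_add _

end Derivations

/-! ## Integral curves -/

section Curves

variable {R : Type u} [TopologicalSpace R] {D : DifferentialStructure R} {X : D.Der} {c : ℝ → R}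
  {I : Set ℝ}

theorem IsIntegralCurveOn.mono (h : IsIntegralCurveOn X c I) {J : Set ℝ} (hJ : J ⊆ I) :
    IsIntegralCurveOn X c J := fun f t ht => (h f t (hJ ht)).mono hJ

theorem IsIntegralCurveOn.congr (h : IsIntegralCurveOn X c I) {c' : ℝ → R} (hc : EqOn c' c I) :
    IsIntegralCurveOn X c' I := by
  intro f t ht
  rw [hc ht]
  exact (h f t ht).congr (fun s hs => by rw [hc hs]) (by rw [hc ht])

/-- Continuity is not part of the definition; it follows because bump functions are differentiable
along the curve and detect every neighbourhood. -/
theorem IsIntegralCurveOn.continuousOn (h : IsIntegralCurveOn X c I) : ContinuousOn c I := by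
  intro t ht
  rw [ContinuousWithinAt, tendsto_nhds]
  intro O hO htO
  obtain ⟨b, hb, hb1, hb0⟩ := D.exists_bump hO htO
  have h1 := (h ⟨b, hb⟩ t ht).continuousWithinAt
  have h2 : ∀ᶠ s in 𝓝[I] t, b (c s) ∈ Ioi (0 : ℝ) :=
    h1 (isOpen_Ioi.mem_nhds (by simp [hb1]))
  filter_upwards [h2] with s hs
  by_contra hsO
  have := hb0 _ hsO
  simp [this] at hs

theorem IsIntegralCurveOn.shift (h : IsIntegralCurveOn X c I) (a : ℝ) :
    IsIntegralCurveOn X (fun s => c (s + a)) ((fun s => s + a) ⁻¹' I) := by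
  intro f t ht
  have h1 := h f (t + a) ht
  have h2 := h1.scomp t (((hasDerivAt_id t).add_const a).hasDerivWithinAt
    (s := (fun s => s + a) ⁻¹' I)) (fun s hs => hs)
  rw [one_smul] at h2
  exact h2

theorem ordConnected_preimage_add {I : Set ℝ} (hI : I.OrdConnected) (a : ℝ) :
    ((fun s : ℝ => s + a) ⁻¹' I).OrdConnected :=
  hI.preimage_mono fun _ _ h => by gcongr

theorem FlowsTo.symm {t : ℝ} {x y : R} (h : FlowsTo X t x y) : FlowsTo X (-t) y x := by
  obtain ⟨I, c, hI, h0, ht, hc, rfl, rfl⟩ := h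
  exact ⟨_, _, ordConnected_preimage_add hI t, by simpa using ht, by simpa using h0, hc.shift t,
    by simp, by simp⟩

theorem IsIntegralCurveOn.coord {n : ℕ} (h : IsIntegralCurveOn X c I) (φ : Fin n → D.algebra)
    {t : ℝ} (ht : t ∈ I) :
    HasDerivWithinAt (fun s => coordMap φ (c s)) (coordVel X φ (c t)) I t :=
  hasDerivWithinAt_pi.2 fun i => h (φ i) t ht

/-- The derivation `X` has integral curves of locally uniform duration. -/
def HasUniformCurves (X : D.Der) : Prop :=
  ∀ p : R, ∃ W ∈ 𝓝 p, ∃ ε : ℝ, 0 < ε ∧ ∀ q ∈ W, ∃ c : ℝ → R, c 0 = q ∧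
    IsIntegralCurveOn X c (Ioo (-ε) ε)

/-- `FlowsTo` supplies a separate curve for each time. The curves reaching times -ε/2 and ε/2 are
glued at 0, where both one-sided derivatives equal X f at the common starting point. -/
theorem IsVectorField.hasUniformCurves (hX : IsVectorField X) : HasUniformCurves X := by
  intro p
  obtain ⟨U, hU, hpU, ε, hε, h⟩ := hX p
  refine ⟨U, hU.mem_nhds hpU, ε / 2, by positivity, fun q hq => ?_⟩
  have key : ∀ t ∈ Ioo (-ε) ε, ∃ (I : Set ℝ) (c : ℝ → R), I.OrdConnected ∧ 0 ∈ I ∧ t ∈ I ∧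
      IsIntegralCurveOn X c I ∧ c 0 = q := by
    intro t ht
    obtain ⟨V, -, e, -, he⟩ := h t ht
    obtain ⟨I, c, hI, h0, hI', hc, hc0, -⟩ := he ⟨q, hq⟩
    exact ⟨I, c, hI, h0, hI', hc, hc0⟩
  obtain ⟨I₁, c₁, hI₁, h0₁, ht₁, hc₁, hq₁⟩ := key (-(ε / 2)) ⟨by linarith, by linarith⟩
  obtain ⟨I₂, c₂, hI₂, h0₂, ht₂, hc₂, hq₂⟩ := key (ε / 2) ⟨by linarith, by linarith⟩
  have hs₁ : Icc (-(ε / 2)) 0 ⊆ I₁ := hI₁.out ht₁ h0₁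
  have hs₂ : Icc 0 (ε / 2) ⊆ I₂ := hI₂.out h0₂ ht₂
  let c : ℝ → R := fun t => if t ≤ 0 then c₁ t else c₂ t
  have hc1 : IsIntegralCurveOn X c (Icc (-(ε / 2)) 0) :=
    (hc₁.mono hs₁).congr fun t ht => if_pos ht.2
  have hc2 : IsIntegralCurveOn X c (Icc 0 (ε / 2)) := by
    refine (hc₂.mono hs₂).congr fun t ht => ?_
    rcases ht.1.eq_or_lt with h0 | h0
    · simp only [c, ← h0, le_refl, if_true, hq₁, hq₂]
    · exact if_neg (not_le.2 h0)
  refine ⟨c, by simp [c, hq₁], fun f t ht => HasDerivAt.hasDerivWithinAt ?_⟩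
  rcases lt_trichotomy t 0 with h0 | h0 | h0
  · exact (hc1 f t ⟨ht.1.le, h0.le⟩).hasDerivAt (Icc_mem_nhds ht.1 h0)
  · subst h0
    have h1 := (hc1 f 0 ⟨ht.1.le, le_rfl⟩).union (hc2 f 0 ⟨le_rfl, ht.2.le⟩)
    rw [Icc_union_Icc_eq_Icc ht.1.le ht.2.le] at h1
    exact h1.hasDerivAt (Icc_mem_nhds ht.1 ht.2)
  · exact (hc2 f t ⟨h0.le, ht.2.le⟩).hasDerivAt (Icc_mem_nhds h0 ht.2)

end Curves

/-! ## Local coordinates -/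

section Coordinates

variable {R : Type u} [TopologicalSpace R] {D : DifferentialStructure R}

/-- The functions `φ` embed the open set `U` into a Cartesian space in such a way that smooth
functions are locally smooth functions of the coordinates. -/
structure IsCoordsOn {n : ℕ} (φ : Fin n → D.algebra) (U : Set R) : Prop where
  isOpen : IsOpen U
  injOn : InjOn (coordMap φ) U
  exists_isOpen : ∀ y ∈ U, ∀ W : Set R, IsOpen W → y ∈ W → ∃ O : Set (Fin n → ℝ), IsOpen O ∧
    coordMap φ y ∈ O ∧ ∀ z ∈ U, coordMap φ z ∈ O → z ∈ W
  exists_rep : ∀ f ∈ D.smooth, ∀ y ∈ U, ∃ W : Set R, IsOpen W ∧ y ∈ W ∧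
    ∃ g : (Fin n → ℝ) → ℝ, ContDiff ℝ ∞ g ∧ ∀ z ∈ W, f z = g (coordMap φ z)

variable (D) in
/-- Differential spaces that are locally diffeomorphic to subspaces of Cartesian spaces. -/
def IsSubcartesian : Prop :=
  ∀ p : R, ∃ (n : ℕ) (φ : Fin n → D.algebra) (U : Set R), p ∈ U ∧ IsCoordsOn φ U

variable (D) in
/-- Differential spaces that are locally diffeomorphic to open subspaces of Cartesian spaces. -/
def IsLocallyCartesian : Prop :=
  ∀ p : R, ∃ (n : ℕ) (φ : Fin n → D.algebra) (U : Set R), p ∈ U ∧ IsCoordsOn φ U ∧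
    IsOpen (coordMap φ '' U)

theorem IsLocallyCartesian.isSubcartesian (h : D.IsLocallyCartesian) : D.IsSubcartesian := by
  intro p
  obtain ⟨n, φ, U, hp, hφ, -⟩ := h p
  exact ⟨n, φ, U, hp, hφ⟩

namespace IsCoordsOn

variable {n : ℕ} {φ : Fin n → D.algebra} {U : Set R}

theorem continuousOn_of_comp (hφ : IsCoordsOn φ U) {α : Type*} [TopologicalSpace α] {c : α → R}
    {s : Set α} (hU : ∀ x ∈ s, c x ∈ U) (hc : ContinuousOn (fun x => coordMap φ (c x)) s) :
    ContinuousOn c s := by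
  intro x hx
  rw [ContinuousWithinAt, tendsto_nhds]
  intro W hW hxW
  obtain ⟨O, hO, hxO, hOW⟩ := hφ.exists_isOpen _ (hU x hx) W hW hxW
  filter_upwards [hc x hx (hO.mem_nhds hxO), self_mem_nhdsWithin] with y hy hys
  exact hOW _ (hU y hys) hy

/-- It is enough to test the coordinates: every smooth function is locally g ∘ φ, and both the
derivation and the derivative along the curve obey the chain rule for g. -/
theorem isIntegralCurveOn (hφ : IsCoordsOn φ U) {X : D.Der} {c : ℝ → R} {I : Set ℝ}
    (hU : ∀ t ∈ I, c t ∈ U)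
    (hc : ∀ t ∈ I, HasDerivWithinAt (fun s => coordMap φ (c s)) (coordVel X φ (c t)) I t) :
    IsIntegralCurveOn X c I := by
  have hcont := hφ.continuousOn_of_comp hU (s := I) fun t ht => (hc t ht).continuousWithinAt
  intro f t ht
  obtain ⟨W, hW, htW, g, hg, hfg⟩ := hφ.exists_rep f.1 f.2 (c t) (hU t ht)
  rw [der_comp_apply X φ hg hW htW hfg]
  have h1 := ((hg.differentiable (by simp) (coordMap φ (c t))).hasFDerivAt).comp_hasDerivWithinAt t
    (hc t ht)
  refine h1.congr_of_eventuallyEq ?_ (hfg _ htW)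
  filter_upwards [hcont t ht (hW.mem_nhds htW)] with s hs
  exact hfg _ hs

/-- In coordinates a derivation is a smooth vector field, which can be cut off. -/
theorem exists_field (hφ : IsCoordsOn φ U) (X : D.Der) {p : R} (hp : p ∈ U) :
    ∃ v : (Fin n → ℝ) → (Fin n → ℝ), ContDiff ℝ ∞ v ∧ HasCompactSupport v ∧
      ∃ W : Set R, IsOpen W ∧ p ∈ W ∧ W ⊆ U ∧ ∀ y ∈ W, v (coordMap φ y) = coordVel X φ y := by
  -- Each X φᵢ is smooth, hence near p a smooth function of the coordinates. The bump function makes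
  -- the field compactly supported, thus globally Lipschitz, without changing it near p.
  choose W hW hpW g hg hgW using fun i => hφ.exists_rep (X (φ i)).1 (X (φ i)).2 p hp
  let b : ContDiffBump (coordMap φ p) := ⟨1, 2, one_pos, one_lt_two⟩
  refine ⟨fun x => b x • fun i => g i x, b.contDiff.smul (contDiff_pi.2 hg), ?_,
    (⋂ i, W i) ∩ coordMap φ ⁻¹' Metric.ball (coordMap φ p) 1 ∩ U, ?_, ?_, inter_subset_right, ?_⟩
  · exact b.hasCompactSupport.smul_right
  · exact ((isOpen_iInter_of_finite hW).inter
      (Metric.isOpen_ball.preimage (continuous_coordMap φ))).inter hφ.isOpen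
  · exact ⟨⟨mem_iInter.2 hpW, Metric.mem_ball_self one_pos⟩, hp⟩
  · intro y hy
    have h1 : b (coordMap φ y) = 1 :=
      b.one_of_mem_closedBall (Metric.ball_subset_closedBall hy.1.2)
    simp only [h1, one_smul]
    exact funext fun i => (hgW i y (mem_iInter.1 hy.1.1 i)).symm

end IsCoordsOn

/-- Integral curves on a subcartesian space are unique. -/
theorem IsSubcartesian.eqOn [T2Space R] (hD : D.IsSubcartesian) {X : D.Der} {c c' : ℝ → R}
    {I : Set ℝ} (hI : I.OrdConnected) (hc : IsIntegralCurveOn X c I)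
    (hc' : IsIntegralCurveOn X c' I) {t₀ : ℝ} (ht₀ : t₀ ∈ I) (h : c t₀ = c' t₀) : EqOn c c' I := by
  refine hI.isPreconnected.forall_of_eventually (P := fun t => c t = c' t) ht₀ h ?_ ?_
  · intro t ht heq
    obtain ⟨n, φ, U, hp, hφ⟩ := hD (c t)
    obtain ⟨v, hv, hvc, W, hW, htW, hWU, hvW⟩ := hφ.exists_field X hp
    obtain ⟨K, hK⟩ := (hv.of_le (m := 1) (by simp)).lipschitzWith_of_hasCompactSupport hvc
      (by simp)
    -- Near t both curves lie in W, where their coordinates solve one Lipschitz equation on ℝⁿ.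
    have h1 : ∀ᶠ s in 𝓝[I] t, c s ∈ W ∧ c' s ∈ W :=
      ((hc.continuousOn t ht).eventually (hW.mem_nhds htW)).and
        ((hc'.continuousOn t ht).eventually (hW.mem_nhds (heq ▸ htW)))
    obtain ⟨δ, hδ, hball⟩ := Metric.mem_nhdsWithin_iff.1 h1
    rw [Real.ball_eq_Ioo] at hball
    have hJ : (Ioo (t - δ) (t + δ) ∩ I).OrdConnected := ordConnected_Ioo.inter hI
    have key : ∀ k : ℝ → R, IsIntegralCurveOn X k I →
        (∀ s ∈ Ioo (t - δ) (t + δ) ∩ I, k s ∈ W) → ∀ s ∈ Ioo (t - δ) (t + δ) ∩ I,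
        HasDerivWithinAt (fun s => coordMap φ (k s)) (v (coordMap φ (k s)))
          (Ioo (t - δ) (t + δ) ∩ I) s := by
      intro k hk hkW s hs
      rw [hvW _ (hkW s hs)]
      exact (hk.coord φ hs.2).mono inter_subset_right
    have h2 := ode_unique_of_ordConnected hK hJ (key c hc fun s hs => (hball hs).1)
      (key c' hc' fun s hs => (hball hs).2) (t₀ := t) ⟨⟨by linarith, by linarith⟩, ht⟩
      (by simp only [heq])
    filter_upwards [Filter.inter_mem (mem_nhdsWithin_of_mem_nhds
      (Ioo_mem_nhds (by linarith : t - δ < t) (by linarith : t < t + δ))) self_mem_nhdsWithin]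
      with s hs
    exact hφ.injOn (hWU (hball hs).1) (hWU (hball hs).2) (h2 hs)
  · intro t ht hne
    have h1 : Filter.Tendsto (fun s => (c s, c' s)) (𝓝[I] t) (𝓝 (c t, c' t)) :=
      (hc.continuousOn t ht).prodMk_nhds (hc'.continuousOn t ht)
    exact h1 (isClosed_diagonal.isOpen_compl.mem_nhds hne)

/-- In coordinates, integral curves that start near a given point follow the flow of a vector field
on the Cartesian space, and they remain in a given neighbourhood for a uniform time. -/
theorem IsCoordsOn.exists_tracking {n : ℕ} {φ : Fin n → D.algebra} {U : Set R}
    (hφ : IsCoordsOn φ U) (X : D.Der) {p : R} (hp : p ∈ U) {N : Set R} (hN : IsOpen N)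
    (hpN : p ∈ N) (s : Set (Fin n → ℝ)) (hs : s ∈ 𝓝 (coordMap φ p)) :
    ∃ r : ℝ, 0 < r ∧ Metric.ball (coordMap φ p) r ⊆ s ∧ ∃ ε : ℝ, 0 < ε ∧
      ∃ θ : ℝ → (Fin n → ℝ) → (Fin n → ℝ),
      (∀ t, ContDiff ℝ ∞ (θ t)) ∧ (∀ x, θ 0 x = x) ∧
      (∀ y ∈ U, coordMap φ y ∈ Metric.ball (coordMap φ p) r → y ∈ N) ∧
      (∀ x, ∀ t ∈ Ioo (-ε) ε, dist (θ t x) x < r / 4) ∧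
      (∀ x, ∀ t ∈ Ioo (-ε) ε, θ (-t) (θ t x) = x) ∧
      (∀ δ ≤ ε, ∀ c : ℝ → R, IsIntegralCurveOn X c (Ioo (-δ) δ) → c 0 ∈ U →
        coordMap φ (c 0) ∈ Metric.ball (coordMap φ p) (r / 2) →
        ∀ t ∈ Ioo (-δ) δ, c t ∈ U ∧ coordMap φ (c t) = θ t (coordMap φ (c 0))) ∧
      ∀ (c : ℝ → R) (x : Fin n → ℝ), x ∈ Metric.ball (coordMap φ p) (r / 2) →
        (∀ t ∈ Ioo (-ε) ε, c t ∈ U ∧ coordMap φ (c t) = θ t x) →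
        IsIntegralCurveOn X c (Ioo (-ε) ε) := by
  obtain ⟨v, hv, hvc, W, hW, hpW, hWU, hvW⟩ := hφ.exists_field X hp
  obtain ⟨K, hK⟩ := (hv.of_le (m := 1) (by simp)).lipschitzWith_of_hasCompactSupport hvc (by simp)
  obtain ⟨b, hb, hb1, hb0⟩ := D.exists_bump (hW.inter hN) ⟨hpW, hpN⟩
  have hbc := D.continuous_of_mem hb
  -- The radius r is chosen such that points of U with coordinates in the closed r-ball have b >
  -- 1/2, and thus lie well inside W ∩ N.
  obtain ⟨O, hO, hpO, hOb⟩ := hφ.exists_isOpen p hp (b ⁻¹' Ioi (1 / 2))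
    (isOpen_Ioi.preimage hbc) (by norm_num [hb1])
  obtain ⟨r, hr, hrO⟩ := Metric.nhds_basis_closedBall.mem_iff.1
    (Filter.inter_mem (hO.mem_nhds hpO) hs)
  have hbWN : ∀ y, 1 / 2 ≤ b y → y ∈ W ∩ N := by
    intro y hy
    by_contra hyW
    have := hb0 y hyW
    rw [this] at hy
    norm_num at hy
  have hQ : ∀ y ∈ U, coordMap φ y ∈ Metric.closedBall (coordMap φ p) r → 1 / 2 ≤ b y :=
    fun y hy hyr => (hOb y hy (hrO hyr).1).le
  -- U is only open, yet this part of it is closed in R, since membership in U can be replaced by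
  -- the closed condition b ≥ 1/2. Hence a curve cannot slip out of U while its coordinates stay in
  -- the ball.
  have hQclosed : IsClosed {y | y ∈ U ∧ coordMap φ y ∈ Metric.closedBall (coordMap φ p) r} := by
    have : {y | y ∈ U ∧ coordMap φ y ∈ Metric.closedBall (coordMap φ p) r} =
        {y | 1 / 2 ≤ b y} ∩ coordMap φ ⁻¹' Metric.closedBall (coordMap φ p) r := by
      ext y
      exact ⟨fun hy => ⟨hQ y hy.1 hy.2, hy.2⟩, fun hy => ⟨hWU (hbWN y hy.1).1, hy.2⟩⟩
    rw [this]
    exact (isClosed_le continuous_const hbc).inter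
      (Metric.isClosed_closedBall.preimage (continuous_coordMap φ))
  obtain ⟨ε, hε, θ, hθ, hθ0, hder, hdist, hinv⟩ :=
    exists_flow_of_hasCompactSupport hv hvc (r := r / 4) (by positivity)
  have hstay : ∀ x ∈ Metric.ball (coordMap φ p) (r / 2), ∀ t ∈ Ioo (-ε) ε,
      θ t x ∈ Metric.closedBall (coordMap φ p) r := by
    intro x hx t ht
    rw [Metric.mem_closedBall]
    rw [Metric.mem_ball] at hx
    linarith [dist_triangle (θ t x) x (coordMap φ p), hdist x t ht]
  refine ⟨r, hr, fun x hx => (hrO (Metric.ball_subset_closedBall hx)).2, ε, hε, θ, hθ, hθ0,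
    fun y hy hyr => (hbWN y (hQ y hy (Metric.ball_subset_closedBall hyr))).2, hdist, hinv, ?_, ?_⟩
  · intro δ hδ c hc hcU hcr
    rcases le_or_gt δ 0 with hδ0 | hδ0
    · intro t ht
      exact absurd (ht.1.trans ht.2) (by linarith)
    have hsub : Ioo (-δ) δ ⊆ Ioo (-ε) ε := Ioo_subset_Ioo (by linarith) hδ
    have h0 : (0 : ℝ) ∈ Ioo (-δ) δ := ⟨by linarith, hδ0⟩
    have hcont : ContinuousOn (fun s => coordMap φ (c s)) (Ioo (-δ) δ) :=
      (continuous_coordMap φ).comp_continuousOn hc.continuousOn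
    have hθcont : ContinuousOn (fun s => θ s (coordMap φ (c 0))) (Ioo (-δ) δ) :=
      fun s hs => (hder _ s (hsub hs)).continuousAt.continuousWithinAt
    refine ordConnected_Ioo.isPreconnected.forall_of_eventually
      (P := fun t => c t ∈ U ∧ coordMap φ (c t) = θ t (coordMap φ (c 0))) h0
      ⟨hcU, by rw [hθ0]⟩ ?_ ?_
    -- Agreement persists by uniqueness for v, which gives the velocity of the coordinates on W.
    · rintro t ht ⟨htU, hteq⟩
      have htW : c t ∈ W :=
        (hbWN _ (hQ _ htU (hteq ▸ hstay _ hcr t (hsub ht)))).1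
      have h1 : ∀ᶠ s in 𝓝[Ioo (-δ) δ] t, c s ∈ W := (hc.continuousOn t ht) (hW.mem_nhds htW)
      obtain ⟨η, hη, hball⟩ := Metric.mem_nhdsWithin_iff.1 h1
      rw [Real.ball_eq_Ioo] at hball
      have hJ : (Ioo (t - η) (t + η) ∩ Ioo (-δ) δ).OrdConnected :=
        ordConnected_Ioo.inter ordConnected_Ioo
      have h2 := ode_unique_of_ordConnected hK hJ (f := fun s => coordMap φ (c s))
        (g := fun s => θ s (coordMap φ (c 0))) (fun s hs => by
          simp only [hvW _ (hball hs)]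
          exact (hc.coord φ hs.2).mono inter_subset_right)
        (fun s hs => (hder _ s (hsub hs.2)).hasDerivWithinAt) (t₀ := t)
        ⟨⟨by linarith, by linarith⟩, ht⟩ hteq
      filter_upwards [Filter.inter_mem (mem_nhdsWithin_of_mem_nhds
        (Ioo_mem_nhds (by linarith : t - η < t) (by linarith : t < t + η))) self_mem_nhdsWithin]
        with s hs
      exact ⟨hWU (hball hs), h2 hs⟩
    -- Failure persists as well: either the coordinates differ, an open condition, or c t is off the
    -- closed set above, which all agreeing points belong to.
    · intro t ht hnot
      by_cases hteq : coordMap φ (c t) = θ t (coordMap φ (c 0))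
      · have hnQ : c t ∉ {y | y ∈ U ∧ coordMap φ y ∈ Metric.closedBall (coordMap φ p) r} :=
          fun h => hnot ⟨h.1, hteq⟩
        filter_upwards [(hc.continuousOn t ht) (hQclosed.isOpen_compl.mem_nhds hnQ),
          self_mem_nhdsWithin] with s hs hsδ hP
        exact hs ⟨hP.1, hP.2 ▸ hstay _ hcr s (hsub hsδ)⟩
      · have h1 := (hcont t ht).prodMk_nhds (hθcont t ht)
        filter_upwards [h1 (isClosed_diagonal.isOpen_compl.mem_nhds hteq)] with s hs hP
        exact hs hP.2
  · intro c x hx hc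
    refine hφ.isIntegralCurveOn (fun t ht => (hc t ht).1) fun t ht => ?_
    have htW : c t ∈ W :=
      (hbWN _ (hQ _ (hc t ht).1 ((hc t ht).2 ▸ hstay x hx t ht))).1
    rw [← hvW _ htW, (hc t ht).2]
    exact (hder x t ht).hasDerivWithinAt.congr (fun s hs => (hc s hs).2) (hc t ht).2

end Coordinates

end DifferentialStructure

namespace DifferentialStructure

/-! ## Vector fields on subcartesian spaces -/

section Subcartesian

variable {R : Type u} [TopologicalSpace R] {D : DifferentialStructure R}

theorem isSmooth_subspace_of_comp {R' : Type v} [TopologicalSpace R']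
    {D' : DifferentialStructure R'} {V : Set R} {f : R' → V} (hf : Continuous f)
    (h : ∀ g ∈ D.smooth, (fun x => g (f x).1) ∈ D'.smooth) : IsSmooth D' (D.subspace V) f := by
  refine ⟨hf, fun g hg => D'.local_mem _ fun x => ?_⟩
  obtain ⟨O, hO, hxO, k, hk, hgk⟩ := hg (f x)
  exact ⟨_, hO.preimage (continuous_subtype_val.comp hf), hxO, _, h k hk,
    fun y hy => (hgk (f y) hy).symm⟩

theorem isSmooth_subtype_val {A : Set R} : IsSmooth (D.subspace A) D Subtype.val :=
  ⟨continuous_subtype_val, fun f hf _ => ⟨univ, isOpen_univ, trivial, f, hf, fun _ _ => rfl⟩⟩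

/-- If f is θ in coordinates and g is locally G ∘ φ, then g ∘ f is locally G ∘ θ ∘ φ. So the flow
maps need to be smooth only in the ambient space. -/
theorem IsCoordsOn.comp_mem_subspace {n : ℕ} {φ : Fin n → D.algebra} {U : Set R}
    (hφ : IsCoordsOn φ U) {A : Set R} (hA : IsOpen A) {f : R → R} (hf : ContinuousOn f A)
    (hfU : ∀ y ∈ A, f y ∈ U) {θ : (Fin n → ℝ) → (Fin n → ℝ)} (hθ : ContDiff ℝ ∞ θ)
    (hfθ : ∀ y ∈ A, coordMap φ (f y) = θ (coordMap φ y)) {g : R → ℝ} (hg : g ∈ D.smooth) :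
    (fun y : A => g (f y.1)) ∈ (D.subspace A).smooth := by
  intro a
  obtain ⟨W, hW, haW, G, hG, hgG⟩ := hφ.exists_rep g hg (f a.1) (hfU a.1 a.2)
  refine ⟨A ∩ f ⁻¹' W, hf.isOpen_inter_preimage hA hW, ⟨a.2, haW⟩,
    fun z => G (θ (coordMap φ z)),
    D.comp_mem n (fun j => (φ j).1) (fun x => G (θ x)) (fun j => (φ j).2) (hG.comp hθ), ?_⟩
  intro y hy
  simp only [hgG _ hy.2, hfθ _ y.2]

/-- On a subcartesian space, a derivation whose integral curves have locally uniform duration is a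
vector field. -/
theorem HasUniformCurves.isVectorField (hD : D.IsSubcartesian) {X : D.Der}
    (hX : HasUniformCurves X) : IsVectorField X := by
  intro p
  obtain ⟨n, φ, U, hp, hφ⟩ := hD p
  obtain ⟨W, hW, δ, hδ, hcurve⟩ := hX p
  obtain ⟨r, hr, -, ε, hε, θ, hθ, hθ0, hN, hdist, hinv, htrack, -⟩ :=
    hφ.exists_tracking X hp isOpen_interior (mem_interior_iff_mem_nhds.2 hW) univ Filter.univ_mem
  choose! c hc0 hc using hcurve
  set η := min ε δ with hη
  have hηpos : 0 < η := lt_min hε hδ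
  have hηε : Ioo (-η) η ⊆ Ioo (-ε) ε :=
    Ioo_subset_Ioo (neg_le_neg (min_le_left _ _)) (min_le_left _ _)
  have hηδ : Ioo (-η) η ⊆ Ioo (-δ) δ :=
    Ioo_subset_Ioo (neg_le_neg (min_le_right _ _)) (min_le_right _ _)
  -- Displacements are below r/4, so points of A (r/4) flow into A (r/2), from where the flow can be
  -- run backwards.
  let A : ℝ → Set R := fun ρ => U ∩ coordMap φ ⁻¹' Metric.ball (coordMap φ p) ρ
  have hA : ∀ ρ, IsOpen (A ρ) := fun ρ =>
    hφ.isOpen.inter (Metric.isOpen_ball.preimage (continuous_coordMap φ))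
  have hAmono : A (r / 4) ⊆ A (r / 2) := fun y hy =>
    ⟨hy.1, Metric.ball_subset_ball (by linarith) hy.2⟩
  have hAW : ∀ y ∈ A (r / 2), y ∈ W := fun y hy =>
    interior_subset (hN y hy.1 (Metric.ball_subset_ball (by linarith) hy.2))
  have hflow : ∀ y ∈ A (r / 2), ∀ t ∈ Ioo (-η) η,
      c y t ∈ U ∧ coordMap φ (c y t) = θ t (coordMap φ y) := by
    intro y hy t ht
    have h0 := hc0 y (hAW y hy)
    have := htrack η (min_le_left _ _) (c y) ((hc y (hAW y hy)).mono hηδ)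
      (by rw [h0]; exact hy.1) (by rw [h0]; exact hy.2) t ht
    rwa [h0] at this
  have hcont : ∀ t ∈ Ioo (-η) η, ContinuousOn (fun y => c y t) (A (r / 2)) := fun t ht =>
    hφ.continuousOn_of_comp (fun y hy => (hflow y hy t ht).1)
      (((hθ t).continuous.comp (continuous_coordMap φ)).continuousOn.congr
        fun y hy => (hflow y hy t ht).2)
  have hmaps : ∀ y ∈ A (r / 4), ∀ t ∈ Ioo (-η) η, c y t ∈ A (r / 2) := by
    intro y hy t ht
    obtain ⟨h1, h2⟩ := hflow y (hAmono hy) t ht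
    refine ⟨h1, ?_⟩
    have h3 := hy.2
    have h4 := hdist (coordMap φ y) t (hηε ht)
    rw [mem_preimage, Metric.mem_ball] at h3 ⊢
    rw [h2]
    linarith [dist_triangle (θ t (coordMap φ y)) (coordMap φ y) (coordMap φ p)]
  have hneg : ∀ {t}, t ∈ Ioo (-η) η → -t ∈ Ioo (-η) η := fun ht =>
    ⟨by linarith [ht.2], by linarith [ht.1]⟩
  have hback : ∀ t ∈ Ioo (-η) η, ∀ y ∈ A (r / 2), c y t ∈ A (r / 2) → c (c y t) (-t) = y := by
    intro t ht y hy hyt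
    obtain ⟨h1, h2⟩ := hflow _ hyt (-t) (hneg ht)
    refine hφ.injOn h1 hy.1 ?_
    rw [h2, (hflow y hy t ht).2, hinv _ t (hηε ht)]
  refine ⟨A (r / 4), hA _, ⟨hp, Metric.mem_ball_self (by positivity)⟩, η, hηpos, fun t ht => ?_⟩
  -- The image of A (r/4), described as a preimage under the time -t flow; this makes it visibly
  -- open.
  let V : Set R := A (r / 2) ∩ (fun z => c z (-t)) ⁻¹' A (r / 4)
  have hV : IsOpen V := (hcont _ (hneg ht)).isOpen_inter_preimage (hA _) (hA _)
  have hmV : ∀ y ∈ A (r / 4), c y t ∈ V := fun y hy =>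
    ⟨hmaps y hy t ht, by
      rw [mem_preimage, hback t ht y (hAmono hy) (hmaps y hy t ht)]
      exact hy⟩
  let e : A (r / 4) ≃ₜ V :=
    { toFun := fun y => ⟨c y.1 t, hmV y.1 y.2⟩
      invFun := fun z => ⟨c z.1 (-t), z.2.2⟩
      left_inv := fun y => Subtype.ext (hback t ht y.1 (hAmono y.2) (hmaps y.1 y.2 t ht))
      right_inv := fun z => Subtype.ext (by
        have := hback (-t) (hneg ht) z.1 z.2.1 (hAmono z.2.2)
        rwa [neg_neg] at this)
      continuous_toFun := ((hcont t ht).mono hAmono).domRestrict.subtype_mk _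
      continuous_invFun :=
        ((hcont (-t) (hneg ht)).mono inter_subset_left).domRestrict.subtype_mk _ }
  refine ⟨V, hV, e, ⟨?_, ?_⟩, ?_⟩
  · exact isSmooth_subspace_of_comp e.continuous fun g hg =>
      hφ.comp_mem_subspace (hA _) ((hcont t ht).mono hAmono)
        (fun y hy => (hflow y (hAmono hy) t ht).1) (hθ t)
        (fun y hy => (hflow y (hAmono hy) t ht).2) hg
  · exact isSmooth_subspace_of_comp e.symm.continuous fun g hg =>
      hφ.comp_mem_subspace hV ((hcont (-t) (hneg ht)).mono inter_subset_left)
        (fun y hy => (hflow y hy.1 (-t) (hneg ht)).1) (hθ (-t))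
        (fun y hy => (hflow y hy.1 (-t) (hneg ht)).2) hg
  · intro y
    exact ⟨Ioo (-η) η, c y.1, ordConnected_Ioo, ⟨by linarith, hηpos⟩, ht,
      (hc y.1 (hAW _ (hAmono y.2))).mono hηδ, hc0 y.1 (hAW _ (hAmono y.2)), rfl⟩

/-- Every derivation of a manifold has integral curves of locally uniform duration. -/
theorem IsLocallyCartesian.hasUniformCurves (hD : D.IsLocallyCartesian) (X : D.Der) :
    HasUniformCurves X := by
  intro p
  obtain ⟨n, φ, U, hp, hφ, hopen⟩ := hD p
  obtain ⟨r, hr, hrU, ε, hε, θ, hθ, hθ0, -, hdist, -, -, hcurve⟩ :=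
    hφ.exists_tracking X hp isOpen_univ trivial _ (hopen.mem_nhds ⟨p, hp, rfl⟩)
  refine ⟨U ∩ coordMap φ ⁻¹' Metric.ball (coordMap φ p) (r / 2),
    (hφ.isOpen.inter (Metric.isOpen_ball.preimage (continuous_coordMap φ))).mem_nhds
      ⟨hp, Metric.mem_ball_self (by positivity)⟩, ε, hε, fun q hq => ?_⟩
  have hex : ∀ t ∈ Ioo (-ε) ε, ∃ y, y ∈ U ∧ coordMap φ y = θ t (coordMap φ q) := by
    intro t ht
    -- Here the openness of the coordinate image enters: the flow of the ambient field stays in it,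
    -- so it lifts to a curve in R.
    have h1 : θ t (coordMap φ q) ∈ Metric.ball (coordMap φ p) r := by
      have h3 := hq.2
      rw [mem_preimage, Metric.mem_ball] at h3
      rw [Metric.mem_ball]
      linarith [dist_triangle (θ t (coordMap φ q)) (coordMap φ q) (coordMap φ p),
        hdist (coordMap φ q) t ht]
    exact hrU h1
  have : Nonempty R := ⟨p⟩
  choose! c hc using hex
  refine ⟨c, ?_, hcurve c _ hq.2 hc⟩
  obtain ⟨h1, h2⟩ := hc 0 ⟨by linarith, hε⟩
  exact hφ.injOn h1 hq.1 (by rw [h2, hθ0])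

/-! ### Restriction to open subsets -/

theorem IsIntegralCurveOn.restrictDer {X : D.Der} {U : Set R} (hU : IsOpen U) {c : ℝ → U}
    {I : Set ℝ} (h : IsIntegralCurveOn X (fun t => (c t).1) I) :
    IsIntegralCurveOn (restrictDer X hU) c I := by
  intro f t ht
  obtain ⟨k, W, hW, hxW, hfk⟩ := exists_extension f (c t)
  have h1 : (DifferentialStructure.restrictDer X hU f).1 (c t) = (X k).1 (c t).1 :=
    der_choose_eq X hU f (c t) k hW hxW hfk
  rw [h1]
  refine (h k t ht).congr_of_eventuallyEq ?_ (hfk _ hxW)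
  filter_upwards [(h.continuousOn t ht).eventually (hW.mem_nhds hxW)] with s hs
  exact hfk _ hs

/-- The point is that the curves stay in U for a uniform time; tracking gives this, with U as the
prescribed neighbourhood. -/
theorem HasUniformCurves.restrictDer (hD : D.IsSubcartesian) {X : D.Der}
    (hX : HasUniformCurves X) {U : Set R} (hU : IsOpen U) :
    HasUniformCurves (restrictDer X hU) := by
  classical
  intro p
  obtain ⟨n, φ, A, hp, hφ⟩ := hD p.1
  obtain ⟨W, hW, δ, hδ, hcurve⟩ := hX p.1
  obtain ⟨r, hr, -, ε, hε, θ, hθ, hθ0, hN, hdist, -, htrack, -⟩ :=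
    hφ.exists_tracking X hp hU p.2 univ Filter.univ_mem
  set η := min ε δ with hη
  have hηε : Ioo (-η) η ⊆ Ioo (-ε) ε :=
    Ioo_subset_Ioo (neg_le_neg (min_le_left _ _)) (min_le_left _ _)
  have hηδ : Ioo (-η) η ⊆ Ioo (-δ) δ :=
    Ioo_subset_Ioo (neg_le_neg (min_le_right _ _)) (min_le_right _ _)
  refine ⟨Subtype.val ⁻¹' (W ∩ (A ∩ coordMap φ ⁻¹' Metric.ball (coordMap φ p.1) (r / 2))),
    continuous_subtype_val.continuousAt (Filter.inter_mem hW
      ((hφ.isOpen.inter (Metric.isOpen_ball.preimage (continuous_coordMap φ))).mem_nhds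
        ⟨hp, Metric.mem_ball_self (by positivity)⟩)), η, lt_min hε hδ, fun q hq => ?_⟩
  obtain ⟨c, hc0, hc⟩ := hcurve q.1 hq.1
  have hcU : ∀ t ∈ Ioo (-η) η, c t ∈ U := by
    intro t ht
    have h1 := htrack η (min_le_left _ _) c (hc.mono hηδ) (by rw [hc0]; exact hq.2.1)
      (by rw [hc0]; exact hq.2.2) t ht
    refine hN _ h1.1 ?_
    have h3 := hq.2.2
    rw [mem_preimage, Metric.mem_ball] at h3
    rw [h1.2, hc0, Metric.mem_ball]
    linarith [dist_triangle (θ t (coordMap φ q.1)) (coordMap φ q.1) (coordMap φ p.1),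
        hdist (coordMap φ q.1) t (hηε ht)]
  refine ⟨fun t => if h : c t ∈ U then ⟨c t, h⟩ else p, ?_, ?_⟩
  · apply Subtype.ext
    simp [hc0]
  · refine IsIntegralCurveOn.restrictDer hU ((hc.mono hηδ).congr fun t ht => ?_)
    simp [hcU t ht]

end Subcartesian

/-! ## Push-forward, products and extensions -/

section Pushforward

variable {R : Type u} {R' : Type v} [TopologicalSpace R] [TopologicalSpace R']
  {D : DifferentialStructure R} {D' : DifferentialStructure R'}

theorem IsIntegralCurveOn.pushforward {X : D.Der} {e : R ≃ₜ R'} (he : IsDiffeo D D' e) {c : ℝ → R}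
    {I : Set ℝ} (h : IsIntegralCurveOn X c I) :
    IsIntegralCurveOn (pushforward he X) (fun t => e (c t)) I := by
  intro f t ht
  have h1 := h ⟨f.1 ∘ e, he.1.2 f.1 f.2⟩ t ht
  have h2 : (DifferentialStructure.pushforward he X f).1 (e (c t)) =
      (X ⟨f.1 ∘ e, he.1.2 f.1 f.2⟩).1 (c t) :=
    congrArg (X ⟨f.1 ∘ e, he.1.2 f.1 f.2⟩).1 (e.symm_apply_apply (c t))
  rw [h2]
  exact h1

theorem HasUniformCurves.pushforward {X : D.Der} {e : R ≃ₜ R'} (he : IsDiffeo D D' e)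
    (hX : HasUniformCurves X) : HasUniformCurves (pushforward he X) := by
  intro p
  obtain ⟨W, hW, ε, hε, h⟩ := hX (e.symm p)
  refine ⟨e.symm ⁻¹' W, e.symm.continuous.continuousAt hW, ε, hε, fun q hq => ?_⟩
  obtain ⟨c, hc0, hc⟩ := h _ hq
  exact ⟨fun t => e (c t), by simp [hc0], hc.pushforward he⟩

/-- The restriction of a smooth function on a product to a slice. -/
def slice (f : (D.prod D').algebra) (z : R') : D.algebra :=
  ⟨fun a => f.1 (a, z), by
    refine D.local_mem _ fun a => ?_
    obtain ⟨U, hU, hx, n, m, α, β, F, hα, hβ, hF, hfF⟩ := f.2 (a, z)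
    exact ⟨_, hU.preimage (Continuous.prodMk_left z), hx,
      fun a => F (fun i => α i a, fun j => β j z),
      D.comp_mem n α (fun p => F (p, fun j => β j z)) hα (hF.comp (by fun_prop)),
      fun y hy => (hfF (y, z) hy).symm⟩⟩

variable (D') in
/-- The lift of a derivation of the first factor to a product. -/
def prodDer (Y : D.Der) : (D.prod D').Der :=
  derOfPointwise (fun f x => (Y (slice f x.2)).1 x.1)
    (by
      intro f x
      obtain ⟨U, hU, hx, n, m, α, β, F, hα, hβ, hF, hfF⟩ := f.2 x
      -- Where f = F(α, β), the new function is the derivative of F at (α, β) in the direction (Y α,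
      -- 0): a smooth function of α and Y α, which make up the n + n functions on the first factor,
      -- and of β.
      refine ⟨U, hU, hx, n + n, m, Fin.append α fun i => (Y ⟨α i, hα i⟩).1, β,
        fun p => fderiv ℝ F (fun i => p.1 (Fin.castAdd n i), p.2)
          (fun i => p.1 (Fin.natAdd n i), 0), ?_, hβ, ?_, ?_⟩
      · intro i
        refine Fin.addCases (fun i => ?_) (fun i => ?_) i
        · rw [Fin.append_left]
          exact hα i
        · rw [Fin.append_right]
          exact (Y ⟨α i, hα i⟩).2
      · exact ((hF.fderiv_right (m := ∞) (by simp)).comp (by fun_prop)).clm_apply (by fun_prop)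
      · intro y hy
        have hG : ContDiff ℝ ∞ fun p : Fin n → ℝ => F (p, fun j => β j y.2) :=
          hF.comp (by fun_prop)
        have h1 := der_comp_apply Y (fun i => ⟨α i, hα i⟩) hG (f := slice f y.2) (y := y.1)
          (hU.preimage (Continuous.prodMk_left y.2)) hy (fun z hz => hfF (z, y.2) hz)
        have h2 : HasFDerivAt (fun p : Fin n → ℝ => F (p, fun j => β j y.2))
            ((fderiv ℝ F (fun i => α i y.1, fun j => β j y.2)).comp
              (ContinuousLinearMap.inl ℝ (Fin n → ℝ) (Fin m → ℝ))) (fun i => α i y.1) :=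
          ((hF.differentiable (by simp) _).hasFDerivAt).comp _
            (hasFDerivAt_prodMk_left (fun i => α i y.1) _)
        refine (h1.trans (congrArg (fun L : (Fin n → ℝ) →L[ℝ] ℝ =>
          L (coordVel Y (fun i => ⟨α i, hα i⟩) y.1)) h2.fderiv)).trans ?_
        change _ = fderiv ℝ F
          (fun i => Fin.append α (fun i => (Y ⟨α i, hα i⟩).1) (Fin.castAdd n i) y.1,
            fun j => β j y.2)
          (fun i => Fin.append α (fun i => (Y ⟨α i, hα i⟩).1) (Fin.natAdd n i) y.1, 0)
        simp only [Fin.append_left, Fin.append_right]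
        rfl)
    (fun f g x => der_add_apply Y (slice f x.2) (slice g x.2) x.1)
    (fun c f x => der_smul_apply Y c (slice f x.2) x.1)
    (fun f g x => der_mul_apply Y (slice f x.2) (slice g x.2) x.1)

theorem IsIntegralCurveOn.prodDer {Y : D.Der} {c : ℝ → R} {I : Set ℝ}
    (h : IsIntegralCurveOn Y c I) (z : R') :
    IsIntegralCurveOn (prodDer D' Y) (fun t => (c t, z)) I :=
  fun f t ht => h (slice f z) t ht

theorem HasUniformCurves.prodDer {Y : D.Der} (hY : HasUniformCurves Y) :
    HasUniformCurves (prodDer D' Y) := by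
  intro p
  obtain ⟨W, hW, ε, hε, h⟩ := hY p.1
  refine ⟨Prod.fst ⁻¹' W, continuous_fst.continuousAt hW, ε, hε, fun q hq => ?_⟩
  obtain ⟨c, hc0, hc⟩ := h _ hq
  exact ⟨fun t => (c t, q.2), by simp [hc0], hc.prodDer q.2⟩

end Pushforward

/-! ### Cut-off functions and extension by zero from open subsets. -/

section Extension

variable {R : Type u}

open Classical in
/-- The product of a cut-off function and a function on an open subset, extended by zero. -/
noncomputable def extendFun (β : R → ℝ) {U : Set R} (g : U → ℝ) (y : R) : ℝ :=
  if h : y ∈ U then β y * g ⟨y, h⟩ else 0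

theorem extendFun_of_mem (β : R → ℝ) {U : Set R} (g : U → ℝ) (y : U) :
    extendFun β g y.1 = β y.1 * g y := dif_pos y.2

theorem extendFun_of_eq_zero {β : R → ℝ} {U : Set R} (g : U → ℝ) {y : R} (hy : β y = 0) :
    extendFun β g y = 0 := by
  by_cases h : y ∈ U
  · simp [extendFun, h, hy]
  · simp [extendFun, h]

variable [TopologicalSpace R] {D : DifferentialStructure R}

variable (D) in
/-- `β` is a smooth cut-off function with values in `[-1, 1]` and support in the open set `U`. -/
structure IsCutoff (β : R → ℝ) (U : Set R) : Prop where
  mem : β ∈ D.smooth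
  isOpen : IsOpen U
  abs_le : ∀ x, |β x| ≤ 1
  exists_isClosed : ∃ K : Set R, IsClosed K ∧ K ⊆ U ∧ ∀ x, x ∉ K → β x = 0

-- A bump function b vanishes off U, but its support may reach the boundary. The transition function
-- of 3b - 1 vanishes off the closed set {b ≥ 1/3} ⊆ U and is 1 where b > 2/3.
variable (D) in
theorem exists_cutoff {x : R} {U : Set R} (hU : IsOpen U) (hx : x ∈ U) :
    ∃ β : R → ℝ, IsCutoff D β U ∧ ∃ W : Set R, IsOpen W ∧ x ∈ W ∧ W ⊆ U ∧ ∀ y ∈ W, β y = 1 := by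
  obtain ⟨b, hb, hb1, hb0⟩ := D.exists_bump hU hx
  have hbc := D.continuous_of_mem hb
  have hsub : ∀ c : ℝ, 0 < c → ∀ y, c ≤ b y → y ∈ U := by
    intro c hc y hy
    by_contra hyU
    rw [hb0 y hyU] at hy
    linarith
  refine ⟨fun y => Real.smoothTransition (3 * b y - 1), ⟨?_, hU, ?_, ?_⟩, b ⁻¹' Ioi (2 / 3),
    isOpen_Ioi.preimage hbc, by norm_num [hb1],
    fun y hy => hsub (2 / 3) (by norm_num) y (le_of_lt hy),
    fun y hy => Real.smoothTransition.one_of_one_le ?_⟩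
  · exact D.comp₁_mem hb (F := fun t => Real.smoothTransition (3 * t - 1))
      (Real.smoothTransition.contDiff.comp (by fun_prop))
  · intro y
    rw [abs_of_nonneg (Real.smoothTransition.nonneg _)]
    exact Real.smoothTransition.le_one _
  · refine ⟨{y | 1 / 3 ≤ b y}, isClosed_le continuous_const hbc, hsub (1 / 3) (by norm_num), ?_⟩
    intro y hy
    have : b y < 1 / 3 := not_le.1 hy
    exact Real.smoothTransition.zero_of_nonpos (by linarith)
  · have : 2 / 3 < b y := hy
    linarith

theorem IsCutoff.extendFun_mem {β : R → ℝ} {U : Set R} (hβ : IsCutoff D β U) {g : U → ℝ}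
    (hg : g ∈ (D.subspace U).smooth) : extendFun β g ∈ D.smooth := by
  obtain ⟨K, hK, hKU, hβK⟩ := hβ.exists_isClosed
  refine D.local_mem _ fun x => ?_
  by_cases hx : x ∈ U
  · obtain ⟨W, hW, hxW, k, hk, hgk⟩ := hg ⟨x, hx⟩
    refine ⟨U ∩ W, hβ.isOpen.inter hW, ⟨hx, hxW⟩, _, D.mul_mem hβ.mem hk, fun y hy => ?_⟩
    rw [extendFun_of_mem β g ⟨y, hy.1⟩, hgk ⟨y, hy.1⟩ hy.2]
  · exact ⟨Kᶜ, hK.isOpen_compl, fun h => hx (hKU h), _, D.const_mem 0,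
      fun y hy => (extendFun_of_eq_zero g (hβK y hy)).symm⟩

/-- The product of a cut-off function and a derivation of an open subspace, extended by zero. -/
noncomputable def IsCutoff.extendDer {β : R → ℝ} {U : Set R} (hβ : IsCutoff D β U)
    (X : (D.subspace U).Der) : D.Der :=
  derOfPointwise (fun f => extendFun β (X (D.restrictFun U f)).1)
    (fun f => hβ.extendFun_mem (X (D.restrictFun U f)).2)
    (fun f g x => by
      by_cases hx : x ∈ U
      · rw [extendFun_of_mem β _ ⟨x, hx⟩, extendFun_of_mem β _ ⟨x, hx⟩,
          extendFun_of_mem β _ ⟨x, hx⟩,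
          ← mul_add, ← der_add_apply X]
        rfl
      · simp [extendFun, hx])
    (fun c f x => by
      by_cases hx : x ∈ U
      · rw [extendFun_of_mem β _ ⟨x, hx⟩, extendFun_of_mem β _ ⟨x, hx⟩]
        have h1 := der_smul_apply X c (D.restrictFun U f) ⟨x, hx⟩
        have h2 : D.restrictFun U (c • f) = c • D.restrictFun U f := rfl
        rw [h2, h1]
        ring
      · simp [extendFun, hx])
    (fun f g x => by
      by_cases hx : x ∈ U
      · rw [extendFun_of_mem β _ ⟨x, hx⟩, extendFun_of_mem β _ ⟨x, hx⟩,
          extendFun_of_mem β _ ⟨x, hx⟩]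
        have h1 := der_mul_apply X (D.restrictFun U f) (D.restrictFun U g) ⟨x, hx⟩
        have h2 : D.restrictFun U (f * g) = D.restrictFun U f * D.restrictFun U g := rfl
        rw [h2, h1]
        simp only [restrictFun]
        ring
      · simp [extendFun, hx])

theorem IsCutoff.extendDer_apply {β : R → ℝ} {U : Set R} (hβ : IsCutoff D β U)
    (X : (D.subspace U).Der) (f : D.algebra) (y : U) :
    (hβ.extendDer X f).1 y.1 = β y.1 * (X (D.restrictFun U f)).1 y :=
  extendFun_of_mem β _ y

theorem IsCutoff.extendDer_apply_of_eq_zero {β : R → ℝ} {U : Set R} (hβ : IsCutoff D β U)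
    (X : (D.subspace U).Der) (f : D.algebra) {y : R} (hy : β y = 0) :
    (hβ.extendDer X f).1 y = 0 :=
  extendFun_of_eq_zero _ hy

theorem IsIntegralCurveOn.extendDer {β : R → ℝ} {U : Set R} (hβ : IsCutoff D β U)
    {X : (D.subspace U).Der} {c : ℝ → U} {I : Set ℝ} (h : IsIntegralCurveOn X c I)
    (hc : ∀ t ∈ I, β (c t).1 = 1) :
    IsIntegralCurveOn (hβ.extendDer X) (fun t => (c t).1) I := by
  intro f t ht
  rw [hβ.extendDer_apply, hc t ht, one_mul]
  exact h (D.restrictFun U f) t ht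

/-- Reparametrizing by a bounded `C¹` speed. -/
theorem exists_reparametrization {h h' : ℝ → ℝ} {T : ℝ} (hT : 0 < T)
    (hd : ∀ s ∈ Icc (-T) T, HasDerivAt h (h' s) s) (hc : ContinuousOn h' (Icc (-T) T))
    (hb : ∀ s, |h s| ≤ 1) :
    ∃ τ : ℝ → ℝ, τ 0 = 0 ∧ ∀ t ∈ Ioo (-T) T, τ t ∈ Icc (-T) T ∧ HasDerivAt τ (h (τ t)) t := by
  obtain ⟨C, hC⟩ := isCompact_Icc.exists_bound_of_continuousOn hc
  have h0 : (0 : ℝ) ∈ Icc (-T) T := ⟨by linarith, hT.le⟩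
  have hC0 : 0 ≤ C := (norm_nonneg _).trans (hC 0 h0)
  have hball : Metric.closedBall (0 : ℝ) T = Icc (-T) T := by
    rw [Real.closedBall_eq_Icc, zero_sub, zero_add]
  -- With speed at most 1, a solution from 0 moves at most T in time T, so the ball of radius T is
  -- exactly large enough.
  have hPL : IsPicardLindelof (fun _ => h) (⟨0, h0⟩ : Icc (-T) T) 0 ⟨T, hT.le⟩ 0 1 ⟨C, hC0⟩ :=
    { lipschitzOnWith := fun _ _ => by
        change LipschitzOnWith _ _ (Metric.closedBall (0 : ℝ) T)
        rw [hball]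
        exact (convex_Icc (-T) T).lipschitzOnWith_of_nnnorm_hasDerivWithin_le
          (fun s hs => (hd s hs).hasDerivWithinAt) hC
      continuousOn := fun _ _ => continuousOn_const
      norm_le := fun _ _ x _ => hb x
      mul_max_le := by
        simp only [sub_zero, zero_sub, neg_neg, max_self, NNReal.coe_one, one_mul, NNReal.coe_zero]
        exact le_rfl }
  obtain ⟨τ, hτ0, hτ⟩ := hPL.exists_eq_forall_mem_Icc_hasDerivWithinAt₀
  change τ 0 = 0 at hτ0
  refine ⟨τ, hτ0, fun t ht => ⟨?_, ?_⟩⟩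
  · have h1 := (convex_Icc (-T) T).norm_image_sub_le_of_norm_hasDerivWithin_le hτ
      (fun s _ => hb (τ s)) h0 (Ioo_subset_Icc_self ht)
    rw [hτ0, sub_zero, sub_zero, one_mul] at h1
    exact abs_le.1 (h1.trans (abs_le.2 ⟨ht.1.le, ht.2.le⟩))
  · exact (hτ t (Ioo_subset_Icc_self ht)).hasDerivAt (Icc_mem_nhds ht.1 ht.2)

/-- An integral curve of βX is one of X run at speed β. Since |β| ≤ 1, it uses up no more parameter
than the time elapsed, so durations do not degenerate near the edge of the support. Off the support
the curves are constant. -/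
theorem HasUniformCurves.extendDer {β : R → ℝ} {U : Set R} (hβ : IsCutoff D β U)
    {X : (D.subspace U).Der} (hX : HasUniformCurves X) : HasUniformCurves (hβ.extendDer X) := by
  intro p
  by_cases hp : p ∈ U
  · obtain ⟨W, hW, ε, hε, hcurve⟩ := hX ⟨p, hp⟩
    refine ⟨Subtype.val '' W, hβ.isOpen.isOpenEmbedding_subtypeVal.image_mem_nhds.2 hW, ε / 2,
      by positivity, ?_⟩
    rintro _ ⟨q, hq, rfl⟩
    obtain ⟨c, hc0, hc⟩ := hcurve q hq
    have hsub : Icc (-(ε / 2)) (ε / 2) ⊆ Ioo (-ε) ε := fun s hs =>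
      ⟨by linarith [hs.1], by linarith [hs.2]⟩
    have hder : ∀ f : (D.subspace U).algebra, ∀ s ∈ Ioo (-ε) ε,
        HasDerivAt (fun s => f.1 (c s)) ((X f).1 (c s)) s := fun f s hs =>
      (hc f s hs).hasDerivAt (isOpen_Ioo.mem_nhds hs)
    obtain ⟨τ, hτ0, hτ⟩ := exists_reparametrization (h := fun s => β (c s).1)
      (h' := fun s => (X (D.restrictFun U ⟨β, hβ.mem⟩)).1 (c s)) (half_pos hε)
      (fun s hs => hder (D.restrictFun U ⟨β, hβ.mem⟩) s (hsub hs))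
      (((D.subspace U).continuous_of_mem (X (D.restrictFun U ⟨β, hβ.mem⟩)).2).comp_continuousOn
        (hc.continuousOn.mono hsub)) (fun s => hβ.abs_le _)
    refine ⟨fun t => (c (τ t)).1, by simp only [hτ0, hc0], fun f t ht => ?_⟩
    obtain ⟨h1, h2⟩ := hτ t ht
    rw [hβ.extendDer_apply]
    exact ((hder (D.restrictFun U f) _ (hsub h1)).scomp t h2).hasDerivWithinAt
  · obtain ⟨K, hK, hKU, hβK⟩ := hβ.exists_isClosed
    refine ⟨Kᶜ, hK.isOpen_compl.mem_nhds fun h => hp (hKU h), 1, one_pos, fun q hq => ?_⟩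
    refine ⟨fun _ => q, rfl, fun f t _ => ?_⟩
    rw [hβ.extendDer_apply_of_eq_zero X f (hβK q hq)]
    exact hasDerivWithinAt_const _ _ _

end Extension

end DifferentialStructure

namespace DifferentialStructure

/-! ## Manifolds as differential spaces -/

section Manifold

variable {R : Type u} [TopologicalSpace R] {D : DifferentialStructure R}

/-- Chart components are defined on U only; multiplied by a cut-off they become global functions
that still equal the chart on W. -/
theorem IsSmoothManifold.isLocallyCartesian (hD : D.IsSmoothManifold) : D.IsLocallyCartesian := by
  obtain ⟨d, hd⟩ := hD
  intro p
  obtain ⟨U, V, hU, hp, hV, e, he⟩ := hd p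
  obtain ⟨β, hβ, W, hW, hpW, hWU, hβW⟩ := D.exists_cutoff hU hp
  have hcoord : ∀ i, (fun y : U => (e y).1 i) ∈ (D.subspace U).smooth := fun i =>
    he.1.2 (fun v => v.1 i) fun _ => ⟨univ, isOpen_univ, trivial, fun x => x i,
      show ContDiff ℝ ∞ _ from contDiff_apply ℝ ℝ i, fun _ _ => rfl⟩
  let φ : Fin d → D.algebra := fun i => ⟨_, hβ.extendFun_mem (hcoord i)⟩
  have hφ : ∀ y (hy : y ∈ W), coordMap φ y = (e ⟨y, hWU hy⟩).1 := by
    intro y hy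
    ext i
    exact (extendFun_of_mem β (fun y : U => (e y).1 i) ⟨y, hWU hy⟩).trans
      (by rw [hβW y hy, one_mul])
  have himage : ∀ W' : Set R, IsOpen W' → IsOpen (Subtype.val '' (e '' (Subtype.val ⁻¹' W'))) :=
    fun W' hW' => hV.isOpenMap_subtype_val _
      (e.isOpenMap _ (hW'.preimage continuous_subtype_val))
  refine ⟨d, φ, W, hpW, ⟨hW, ?_, ?_, ?_⟩, ?_⟩
  · intro y hy z hz h
    rw [hφ y hy, hφ z hz] at h
    exact congrArg Subtype.val (e.injective (Subtype.ext h))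
  · intro y hy W' hW' hyW'
    refine ⟨_, himage W' hW', ⟨_, ⟨⟨y, hWU hy⟩, hyW', rfl⟩, (hφ y hy).symm⟩, ?_⟩
    rintro z hz ⟨_, ⟨w, hw, rfl⟩, h⟩
    rw [hφ z hz] at h
    have h2 := e.injective (Subtype.ext h)
    rw [h2] at hw
    exact hw
  · intro f hf y hy
    obtain ⟨O, hO, hyO, g, hg, hfg⟩ := he.2.2 (fun z : U => f z.1)
      (isSmooth_subtype_val.2 f hf) (e ⟨y, hWU hy⟩)
    refine ⟨W ∩ coordMap φ ⁻¹' O, hW.inter (hO.preimage (continuous_coordMap φ)), ⟨hy, ?_⟩,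
      g, hg, ?_⟩
    · rw [mem_preimage, hφ y hy]
      exact hyO
    · rintro z ⟨hz, hzO⟩
      rw [mem_preimage, hφ z hz] at hzO
      rw [hφ z hz, ← hfg _ hzO]
      simp
  · convert himage W hW using 1
    ext v
    constructor
    · rintro ⟨y, hy, rfl⟩
      exact ⟨_, ⟨⟨y, hWU hy⟩, hy, rfl⟩, (hφ y hy).symm⟩
    · rintro ⟨_, ⟨y, hy, rfl⟩, rfl⟩
      exact ⟨y.1, hy, hφ y.1 hy⟩

theorem contDiff_of_algebra {d : ℕ} (f : (euclidean d).algebra) : ContDiff ℝ ∞ f.1 := f.2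

theorem differentiable_of_algebra {d : ℕ} (f : (euclidean d).algebra) : Differentiable ℝ f.1 :=
  (contDiff_of_algebra f).differentiable (by simp)

/-- The directional derivative in a Cartesian space. -/
noncomputable def directionalDer {d : ℕ} (w : Fin d → ℝ) : (euclidean d).Der :=
  derOfPointwise (fun f x => fderiv ℝ f.1 x w)
    (fun f => show ContDiff ℝ ∞ _ from
      ((contDiff_of_algebra f).fderiv_right (m := ∞) (by simp)).clm_apply contDiff_const)
    (fun f g x => congrArg (fun L : (Fin d → ℝ) →L[ℝ] ℝ => L w)
      (fderiv_add (differentiable_of_algebra f x) (differentiable_of_algebra g x)))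
    (fun c f x => congrArg (fun L : (Fin d → ℝ) →L[ℝ] ℝ => L w)
      (fderiv_const_smul (differentiable_of_algebra f x) c))
    (fun f g x => congrArg (fun L : (Fin d → ℝ) →L[ℝ] ℝ => L w)
      (fderiv_mul (differentiable_of_algebra f x) (differentiable_of_algebra g x)))

theorem isIntegralCurveOn_directionalDer {d : ℕ} (u w : Fin d → ℝ) (I : Set ℝ) :
    IsIntegralCurveOn (directionalDer w) (fun t => u + t • w) I := by
  intro f t _
  have h1 : HasDerivAt (fun s : ℝ => u + s • w) w t := by
    simpa using ((hasDerivAt_id t).smul_const w).const_add u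
  exact ((differentiable_of_algebra f _).hasFDerivAt.comp_hasDerivAt t h1).hasDerivWithinAt

theorem IsDiffeo.symm {R' : Type v} [TopologicalSpace R'] {D' : DifferentialStructure R'}
    {e : R ≃ₜ R'} (he : IsDiffeo D D' e) : IsDiffeo D' D e.symm := ⟨he.2, he.1⟩

/-- In a manifold, neighbouring points are joined by integral curves inside a given
neighbourhood. -/
theorem IsSmoothManifold.exists_integralCurve (hD : D.IsSmoothManifold) {x : R} {G : Set R}
    (hG : G ∈ 𝓝 x) : ∀ᶠ y in 𝓝 x, ∃ (Y : D.Der) (c : ℝ → R),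
      IsIntegralCurveOn Y c (Icc 0 1) ∧ c 0 = x ∧ c 1 = y ∧ ∀ t ∈ Icc (0 : ℝ) 1, c t ∈ G := by
  classical
  obtain ⟨d, hd⟩ := hD
  obtain ⟨U, V, hU, hx, hV, e, he⟩ := hd x
  obtain ⟨β, hβ, W, hW, hxW, hWU, hβW⟩ := D.exists_cutoff hU hx
  have hO : IsOpen (Subtype.val '' (e '' (Subtype.val ⁻¹' (W ∩ interior G)))) :=
    hV.isOpenMap_subtype_val _
      (e.isOpenMap _ ((hW.inter isOpen_interior).preimage continuous_subtype_val))
  obtain ⟨r, hr, hball⟩ := Metric.isOpen_iff.1 hO (e ⟨x, hx⟩).1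
    ⟨_, ⟨⟨x, hx⟩, ⟨hxW, mem_interior_iff_mem_nhds.2 hG⟩, rfl⟩, rfl⟩
  have hballV : ∀ v ∈ Metric.ball (e ⟨x, hx⟩).1 r, ∃ h : v ∈ V,
      (e.symm ⟨v, h⟩).1 ∈ W ∩ interior G := by
    intro v hv
    obtain ⟨_, ⟨y, hy, rfl⟩, rfl⟩ := hball hv
    exact ⟨(e y).2, by simpa using hy⟩
  have hnear : ∀ᶠ y : U in 𝓝 ⟨x, hx⟩, (e y).1 ∈ Metric.ball (e ⟨x, hx⟩).1 r :=
    (continuous_subtype_val.comp e.continuous).continuousAt.eventually (Metric.ball_mem_nhds _ hr)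
  have hnear' : ∀ᶠ y in 𝓝 x, ∃ h : y ∈ U, (e ⟨y, h⟩).1 ∈ Metric.ball (e ⟨x, hx⟩).1 r := by
    rw [← hU.isOpenEmbedding_subtypeVal.map_nhds_eq ⟨x, hx⟩, Filter.eventually_map]
    filter_upwards [hnear] with y hy
    exact ⟨y.2, hy⟩
  filter_upwards [hnear'] with y ⟨hy, hyr⟩
  set u := (e ⟨x, hx⟩).1 with hu
  -- In the chart the constant field w carries u to the image of y in time 1 along a segment, which
  -- the convex ball contains.
  set w := (e ⟨y, hy⟩).1 - u with hw
  have hline : ∀ t ∈ Icc (0 : ℝ) 1, u + t • w ∈ Metric.ball u r := by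
    intro t ht
    rw [Metric.mem_ball, dist_eq_norm, ← hw] at hyr
    rw [Metric.mem_ball, dist_eq_norm, add_sub_cancel_left, norm_smul, Real.norm_of_nonneg ht.1]
    exact (mul_le_of_le_one_left (norm_nonneg _) ht.2).trans_lt hyr
  let c : ℝ → V := fun t => if h : u + t • w ∈ V then ⟨u + t • w, h⟩ else e ⟨x, hx⟩
  have hc : ∀ t ∈ Icc (0 : ℝ) 1, (c t).1 = u + t • w := by
    intro t ht
    obtain ⟨h, -⟩ := hballV _ (hline t ht)
    simp only [c, h, dif_pos]
  have hcW : ∀ t ∈ Icc (0 : ℝ) 1, (e.symm (c t)).1 ∈ W ∩ interior G := by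
    intro t ht
    obtain ⟨h, h2⟩ := hballV _ (hline t ht)
    rwa [show c t = ⟨_, h⟩ from Subtype.ext (hc t ht)]
  have h1 : IsIntegralCurveOn (restrictDer (directionalDer w) hV) c (Icc 0 1) :=
    IsIntegralCurveOn.restrictDer hV
      ((isIntegralCurveOn_directionalDer u w _).congr fun t ht => hc t ht)
  -- The cut-off is 1 along the curve, so making the field global leaves the curve unchanged.
  have h2 := (h1.pushforward he.symm).extendDer hβ fun t ht => hβW _ (hcW t ht).1
  refine ⟨_, _, h2, ?_, ?_, fun t ht => interior_subset (hcW t ht).2⟩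
  · have : c 0 = e ⟨x, hx⟩ := Subtype.ext (by rw [hc 0 ⟨le_rfl, zero_le_one⟩]; simp [hu])
    simp only [this, Homeomorph.symm_apply_apply]
  · have : c 1 = e ⟨y, hy⟩ := Subtype.ext (by rw [hc 1 ⟨zero_le_one, le_rfl⟩]; simp [hw])
    simp only [this, Homeomorph.symm_apply_apply]

end Manifold

end DifferentialStructure

/-! ## Smooth stratified spaces as subcartesian spaces -/

namespace SmoothStratification

variable {S : Type u} [TopologicalSpace S]

theorem eq_of_mem (T : SmoothStratification S) {M N : Set S} (hM : M ∈ T.strata)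
    (hN : N ∈ T.strata) {x : S} (hxM : x ∈ M) (hxN : x ∈ N) : M = N :=
  (T.isPartition.2 x).unique ⟨hM, hxM⟩ ⟨hN, hxN⟩

variable [T2Space S] [ParacompactSpace S]

/-- Compatibility makes chart coordinates smooth in every chart of the atlas; off the closed support
the function is zero. -/
theorem extendFun_chart_mem (T : SmoothStratification S) {χ : StratifiedChart T.toStratification}
    (hχ : χ ∈ T.atlas) {β : S → ℝ} (hβ : IsCutoff T.differentialStructure β χ.source)
    (i : Fin χ.dim) : extendFun β (fun y => χ.toFun y i) ∈ T.differentialStructure.smooth := by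
  obtain ⟨K, hK, hKχ, hβK⟩ := hβ.exists_isClosed
  refine ⟨?_, ?_⟩
  · rw [continuous_iff_continuousAt]
    intro y
    by_cases hy : y ∈ χ.source
    · have h1 : Continuous fun z : χ.source => extendFun β (fun y => χ.toFun y i) z.1 := by
        simp only [extendFun_of_mem]
        exact (hβ.mem.1.comp continuous_subtype_val).mul
          ((continuous_apply i).comp χ.isEmbedding.continuous)
      exact (continuousOn_iff_continuous_domRestrict.2 h1).continuousAt
        (χ.isOpen_source.mem_nhds hy)
    · refine (continuousAt_const (y := (0 : ℝ))).congr ?_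
      filter_upwards [hK.isOpen_compl.mem_nhds fun h => hy (hKχ h)] with z hz
      exact (extendFun_of_eq_zero _ (hβK z hz)).symm
  · intro ψ hψ y hy
    by_cases hyχ : y ∈ χ.source
    · obtain ⟨W, hW, hyW, -, g, hg, hgW⟩ := T.compatible χ hχ ψ hψ y ⟨hyχ, hy⟩
      obtain ⟨W', hW', hyW', hWψ, k, hk, hkW⟩ := hβ.mem.2 ψ hψ y hy
      refine ⟨W ∩ W' ∩ χ.source, (hW.inter hW').inter χ.isOpen_source, ⟨⟨hyW, hyW'⟩, hyχ⟩,
        fun z hz => hWψ hz.1.2, fun v => k v * g v i, hk.mul (contDiff_pi.1 hg i), ?_⟩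
      intro z hz
      rw [extendFun_of_mem β _ ⟨z, hz.2⟩, hkW z hz.1.2, hgW z hz.1.1 hz.2 (hWψ hz.1.2)]
    · exact ⟨Kᶜ ∩ ψ.source, hK.isOpen_compl.inter ψ.isOpen_source, ⟨fun h => hyχ (hKχ h), hy⟩,
        inter_subset_right, fun _ => 0, contDiff_const,
        fun z hz => extendFun_of_eq_zero _ (hβK z hz.1)⟩

/-- Cut-off coordinates of an atlas chart serve; smooth functions are functions of them by
definition. -/
theorem isSubcartesian (T : SmoothStratification S) :
    T.differentialStructure.IsSubcartesian := by
  intro p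
  obtain ⟨χ, hχ, hp⟩ := T.covers p
  obtain ⟨β, hβ, W, hW, hpW, hWχ, hβW⟩ :=
    T.differentialStructure.exists_cutoff χ.isOpen_source hp
  let φ : Fin χ.dim → T.differentialStructure.algebra := fun i =>
    ⟨_, T.extendFun_chart_mem hχ hβ i⟩
  have hφ : ∀ y (hy : y ∈ W), coordMap φ y = χ.toFun ⟨y, hWχ hy⟩ := by
    intro y hy
    ext i
    exact (extendFun_of_mem β (fun y => χ.toFun y i) ⟨y, hWχ hy⟩).trans
      (by rw [hβW y hy, one_mul])
  refine ⟨χ.dim, φ, W, hpW, hW, ?_, ?_, ?_⟩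
  · intro y hy z hz h
    rw [hφ y hy, hφ z hz] at h
    exact congrArg Subtype.val (χ.isEmbedding.injective h)
  · intro y hy W' hW' hyW'
    obtain ⟨O, hO, hOW⟩ := χ.isEmbedding.isOpen_iff.1
      (hW'.preimage (continuous_subtype_val (p := (· ∈ χ.source))))
    have hiff : ∀ z (hz : z ∈ W), coordMap φ z ∈ O ↔ z ∈ W' := by
      intro z hz
      rw [hφ z hz]
      exact Set.ext_iff.1 hOW ⟨z, hWχ hz⟩
    exact ⟨O, hO, (hiff y hy).2 hyW', fun z hz => (hiff z hz).1⟩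
  · intro f hf y hy
    obtain ⟨W', hW', hyW', hWχ', g, hg, hfg⟩ := hf.2 χ hχ y (hWχ hy)
    exact ⟨W ∩ W', hW.inter hW', ⟨hy, hyW'⟩, g, hg, fun z hz => by rw [hφ z hz.1, hfg z hz.2]⟩

/-! ## Strongly stratified vector fields -/

/-- Integral curves of a derivation that restricts to the strata stay in their stratum. -/
theorem integralCurve_mem (T : SmoothStratification S) {X : T.differentialStructure.Der}
    (hX : ∀ M : T.strata, T.RestrictsTo X M) {c : ℝ → S} {I : Set ℝ} (hI : I.OrdConnected)
    (hc : IsIntegralCurveOn X c I) {M : Set S} (hM : M ∈ T.strata) {t₀ : ℝ} (ht₀ : t₀ ∈ I)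
    (h : c t₀ ∈ M) : ∀ t ∈ I, c t ∈ M := by
  have key : ∀ N ∈ T.strata, ∀ t ∈ I, c t ∈ N → ∀ᶠ s in 𝓝[I] t, c s ∈ N := by
    intro N hN t ht htN
    obtain ⟨Y, hY⟩ := hX ⟨N, hN⟩
    obtain ⟨G, hG, ε, hε, hcurve⟩ :=
      (T.isSmoothManifold ⟨N, hN⟩).isLocallyCartesian.hasUniformCurves Y ⟨c t, htN⟩
    obtain ⟨γ, hγ0, hγ⟩ := hcurve _ (mem_of_mem_nhds hG)
    -- The integral curve of Y in the manifold N is also one of X in S. By uniqueness c coincides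
    -- with it near t, so c remains in N for a while.
    have h1 : IsIntegralCurveOn X (fun s => (γ s).1) (Ioo (-ε) ε) := by
      intro f s hs
      have h2 := hγ (T.restrictStratum ⟨N, hN⟩ f) s hs
      rw [hY f] at h2
      exact h2
    have h3 := T.isSubcartesian.eqOn (hI.inter (ordConnected_preimage_add ordConnected_Ioo (-t)))
      (hc.mono inter_subset_left) ((h1.shift (-t)).mono inter_subset_right) (t₀ := t)
      ⟨ht, by simp [hε]⟩ (by simp [hγ0])
    have h4 : (fun s : ℝ => s + -t) ⁻¹' Ioo (-ε) ε ∈ 𝓝 t :=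
      (isOpen_Ioo.preimage (by fun_prop)).mem_nhds (by simp [hε])
    filter_upwards [self_mem_nhdsWithin, mem_nhdsWithin_of_mem_nhds h4] with s hs hs'
    rw [h3 ⟨hs, hs'⟩]
    exact (γ (s + -t)).2
  -- For every stratum the set of times spent in it is thus open in I, and the strata are disjoint.
  refine hI.isPreconnected.forall_of_eventually (P := fun t => c t ∈ M) ht₀ h (key M hM) ?_
  intro t ht htM
  obtain ⟨N, ⟨hN, htN⟩, -⟩ := T.isPartition.2 (c t)
  filter_upwards [key N hN t ht htN] with s hs hsM
  exact htM (T.eq_of_mem hN hM hs hsM ▸ htN)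

theorem flowsTo_mem (T : SmoothStratification S) {X : T.differentialStructure.Der}
    (hX : X ∈ T.stronglyStratified) {t : ℝ} {x y : S} (h : FlowsTo X t x y) {M : Set S}
    (hM : M ∈ T.strata) (hx : x ∈ M) : y ∈ M := by
  obtain ⟨I, c, hI, h0, ht, hc, rfl, rfl⟩ := h
  exact T.integralCurve_mem hX.2 hI hc hM h0 hx t ht

/-- A derivation is tangent to `M` if it maps functions that vanish on `M` near a point of `M` to
functions that vanish at this point. -/
def IsTangentTo (T : SmoothStratification S) (X : T.differentialStructure.Der) (M : Set S) : Prop :=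
  ∀ (f : T.differentialStructure.algebra), ∀ p ∈ M, ∀ O : Set S, IsOpen O → p ∈ O →
    (∀ y ∈ M, y ∈ O → f.1 y = 0) → (X f).1 p = 0

/-- Locality of the derivation on the stratum. -/
theorem RestrictsTo.isTangentTo {T : SmoothStratification S} {X : T.differentialStructure.Der}
    {M : T.strata} (h : T.RestrictsTo X M) : T.IsTangentTo X M.1 := by
  obtain ⟨Y, hY⟩ := h
  intro f p hp O hO hpO hf
  have h1 : (Y (T.restrictStratum M f)).1 ⟨p, hp⟩ = (Y 0).1 ⟨p, hp⟩ :=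
    der_congr Y (hO.preimage continuous_subtype_val) hpO fun y hy => hf y.1 y.2 hy
  rw [hY, map_zero] at h1
  exact h1

/-- The manifold `M` is a differential subspace of the stratified space. -/
def IsInducedOn (T : SmoothStratification S) (M : T.strata) : Prop :=
  ∀ g ∈ (T.manifold M).smooth, ∀ x : M.1, ∃ O : Set S, IsOpen O ∧ x.1 ∈ O ∧
    ∃ k : T.differentialStructure.algebra, ∀ y : M.1, y.1 ∈ O → g y = k.1 y.1

/-- In the trivialization g extends as (a, z) ↦ g a, and e(y) = (y, o) on M ∩ U shows that this is
an extension. -/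
theorem IsLocallyTrivial.isInducedOn {T : SmoothStratification S} (hT : T.IsLocallyTrivial)
    (M : T.strata) : T.IsInducedOn M := by
  intro g hg x
  obtain ⟨U, hU, hxU, F, _, _, _, _, T', o, -, e, he, heM, -⟩ := hT M x.1 x.2
  have h1 : (fun p : {p : M.1 | p.1 ∈ U} × F => g p.1.1) ∈
      ((T.openPart M U).prod T'.differentialStructure).smooth := fun _ =>
    ⟨univ, isOpen_univ, trivial, 1, 0, fun _ p => g p.1, fun i => i.elim0, fun v => v.1 0,
      fun _ => isSmooth_subtype_val.2 g hg, fun i => i.elim0, by fun_prop, fun _ _ => rfl⟩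
  obtain ⟨O, hO, hxO, k, hk, hgk⟩ := he.1.2 _ h1 ⟨x.1, hxU⟩
  refine ⟨U ∩ O, hU.inter hO, ⟨hxU, hxO⟩, ⟨k, hk⟩, fun y hy => ?_⟩
  have h2 := hgk ⟨y.1, hy.1⟩ hy.2
  simp only [Function.comp_apply, heM y hy.1] at h2
  exact h2

/-- The derivation on M applies X to a local extension of the function; tangency says exactly that
the choice of extension does not matter. -/
theorem IsTangentTo.restrictsTo {T : SmoothStratification S} {X : T.differentialStructure.Der}
    {M : T.strata} (hX : T.IsTangentTo X M.1) (hM : T.IsInducedOn M) : T.RestrictsTo X M := by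
  have hM' : ∀ (g : (T.manifold M).algebra) (x : M.1), ∃ (k : T.differentialStructure.algebra)
      (O : Set S), IsOpen O ∧ x.1 ∈ O ∧ ∀ y : M.1, y.1 ∈ O → g.1 y = k.1 y.1 := by
    intro g x
    obtain ⟨O, hO, hx, k, hk⟩ := hM g.1 g.2 x
    exact ⟨k, O, hO, hx, hk⟩
  choose k O hO hxO hk using hM'
  have key : ∀ (g : (T.manifold M).algebra) (x : M.1) (k' : T.differentialStructure.algebra)
      (O' : Set S), IsOpen O' → x.1 ∈ O' → (∀ y : M.1, y.1 ∈ O' → g.1 y = k'.1 y.1) →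
      (X (k g x)).1 x.1 = (X k').1 x.1 := by
    intro g x k' O' hO' hxO' hk'
    have h1 := hX (k g x - k') x.1 x.2 (O g x ∩ O') ((hO g x).inter hO') ⟨hxO g x, hxO'⟩
      (fun y hy hyO => by
        have h2 := (hk g x ⟨y, hy⟩ hyO.1).symm.trans (hk' ⟨y, hy⟩ hyO.2)
        exact sub_eq_zero.2 h2)
    rw [map_sub] at h1
    exact sub_eq_zero.1 h1
  refine ⟨derOfPointwise (fun g x => (X (k g x)).1 x.1) ?_ ?_ ?_ ?_, ?_⟩
  · intro g
    refine (T.manifold M).local_mem _ fun x => ⟨_, (hO g x).preimage continuous_subtype_val,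
      hxO g x, _, T.restrict_mem M (X (k g x)), fun y hy => ?_⟩
    exact (key g y (k g x) _ (hO g x) hy (hk g x)).symm
  · intro f g x
    rw [← der_add_apply]
    exact key _ x _ _ ((hO f x).inter (hO g x)) ⟨hxO f x, hxO g x⟩ fun y hy =>
      congrArg₂ (· + ·) (hk f x y hy.1) (hk g x y hy.2)
  · intro a f x
    rw [← der_smul_apply]
    exact key _ x _ _ (hO f x) (hxO f x) fun y hy => congrArg (a * ·) (hk f x y hy)
  · intro f g x
    rw [hk f x x (hxO f x), hk g x x (hxO g x), ← der_mul_apply]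
    exact key _ x _ _ ((hO f x).inter (hO g x)) ⟨hxO f x, hxO g x⟩ fun y hy =>
      congrArg₂ (· * ·) (hk f x y hy.1) (hk g x y hy.2)
  · intro f
    exact eq_of_apply_eq fun x => key _ x f univ isOpen_univ trivial fun _ _ => rfl

/-- The working criterion for membership: neither a flow by diffeomorphisms nor derivations on the
strata need be exhibited. -/
theorem mem_stronglyStratified {T : SmoothStratification S} (hT : T.IsLocallyTrivial)
    {X : T.differentialStructure.Der} (hX : HasUniformCurves X)
    (hX' : ∀ M ∈ T.strata, T.IsTangentTo X M) : X ∈ T.stronglyStratified :=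
  ⟨hX.isVectorField T.isSubcartesian, fun M => (hX' M.1 M.2).restrictsTo (hT.isInducedOn M)⟩

/-- A multiple of a derivation of an open subspace by a cut-off function is tangent to a set if the
derivation is. -/
theorem isTangentTo_extendDer {T : SmoothStratification S} {β : S → ℝ} {U : Set S}
    (hβ : IsCutoff T.differentialStructure β U) {X : (T.differentialStructure.subspace U).Der}
    {M : Set S} (h : ∀ (f : T.differentialStructure.algebra) (p : U), p.1 ∈ M → ∀ O : Set S,
      IsOpen O → p.1 ∈ O → (∀ y ∈ M, y ∈ O → f.1 y = 0) →
        (X (T.differentialStructure.restrictFun U f)).1 p = 0) :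
    T.IsTangentTo (hβ.extendDer X) M := by
  intro f p hp O hO hpO hf
  by_cases hpU : p ∈ U
  · rw [hβ.extendDer_apply X f ⟨p, hpU⟩, h f ⟨p, hpU⟩ hp O hO hpO hf, mul_zero]
  · obtain ⟨K, -, hKU, hβK⟩ := hβ.exists_isClosed
    exact hβ.extendDer_apply_of_eq_zero X f (hβK p fun h => hpU (hKU h))

/-- Z is the push-forward times a cut-off. Uniform curves survive restriction, push-forward and
cut-off; tangency is transported from Y because the flow e of X maps each stratum into itself. -/
theorem isLocallyComplete {T : SmoothStratification S} (hT : T.IsLocallyTrivial) :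
    IsLocallyComplete T.stronglyStratified := by
  intro X hX Y hY t U V hU hV e he hflow x hx
  obtain ⟨β, hβ, W, hW, hxW, hWV, hβW⟩ := T.differentialStructure.exists_cutoff hV hx
  refine ⟨W, hWV, hW, hxW, hβ.extendDer (pushforward he (restrictDer Y hU)), ?_, ?_⟩
  · refine mem_stronglyStratified hT
      (((hY.1.hasUniformCurves.restrictDer T.isSubcartesian hU).pushforward he).extendDer hβ)
      fun M hM => isTangentTo_extendDer hβ fun f p hp O hO hpO hf => ?_
    set q := e.symm p with hq
    have hqp : e q = p := e.apply_symm_apply p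
    have hqM : q.1 ∈ M := by
      have h1 := (hflow q).symm
      rw [hqp] at h1
      exact T.flowsTo_mem hX h1 hM hp
    let g : (T.differentialStructure.subspace U).algebra :=
      ⟨(T.differentialStructure.restrictFun V f).1 ∘ e,
        he.1.2 _ (T.differentialStructure.restrictFun V f).2⟩
    obtain ⟨k, O', hO', hqO', hgk⟩ := exists_extension g q
    have h2 : (restrictDer Y hU g).1 q = (Y k).1 q.1 := der_choose_eq Y hU g q k hO' hqO' hgk
    have hO'' : IsOpen (Subtype.val '' (e ⁻¹' (Subtype.val ⁻¹' O)) : Set S) :=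
      hU.isOpenMap_subtype_val _ ((hO.preimage continuous_subtype_val).preimage e.continuous)
    -- Points of M near q are carried by e to points of M near p, where f vanishes; so k vanishes on
    -- M near q.
    have h3 : (Y k).1 q.1 = 0 := by
      refine (hY.2 ⟨M, hM⟩).isTangentTo k q.1 hqM _ (hO''.inter hO')
        ⟨⟨q, by rw [mem_preimage, hqp]; exact hpO, rfl⟩, hqO'⟩ ?_
      rintro _ hyM ⟨⟨y, hyO, rfl⟩, hyO'⟩
      rw [← hgk y hyO']
      exact hf _ (T.flowsTo_mem hX (hflow y) hM hyM) hyO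
    exact h2.trans h3
  · intro f p hp
    rw [hβ.extendDer_apply _ f ⟨p, hWV hp⟩, hβW p hp, one_mul]

/-- Vector fields on a stratum extend locally to strongly stratified vector fields. -/
theorem exists_lift {T : SmoothStratification S} (hT : T.IsLocallyTrivial) (M : T.strata)
    (x : M.1) : ∃ G ∈ 𝓝 x, ∀ Y : (T.manifold M).Der, ∃ X ∈ T.stronglyStratified,
      ∀ (c : ℝ → M.1) (I : Set ℝ), IsIntegralCurveOn Y c I → (∀ t ∈ I, c t ∈ G) →
        IsIntegralCurveOn X (fun t => (c t).1) I := by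
  classical
  obtain ⟨U, hU, hxU, F, _, _, _, _, T', o, -, e, he, heM, heN⟩ := hT M x.1 x.2
  obtain ⟨β, hβ, W, hW, hxW, hWU, hβW⟩ := T.differentialStructure.exists_cutoff hU hxU
  have hA : IsOpen {p : M.1 | p.1 ∈ U} := hU.preimage continuous_subtype_val
  refine ⟨Subtype.val ⁻¹' W, (hW.preimage continuous_subtype_val).mem_nhds hxW, fun Y => ?_⟩
  let Y' : (T.openPart M U).Der := restrictDer Y hA
  have hY' : HasUniformCurves Y' :=
    HasUniformCurves.restrictDer (T.isSmoothManifold M).isLocallyCartesian.isSubcartesian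
      ((T.isSmoothManifold M).isLocallyCartesian.hasUniformCurves Y) hA
  -- In the trivialization the lift moves only the first factor.
  let Z : (T.differentialStructure.subspace U).Der :=
    pushforward he.symm (prodDer T'.differentialStructure Y')
  have hZ : HasUniformCurves Z := hY'.prodDer.pushforward he.symm
  refine ⟨hβ.extendDer Z, mem_stronglyStratified hT (hZ.extendDer hβ) fun N hN =>
    isTangentTo_extendDer hβ fun f p hp O hO hpO hf => ?_, fun c I hc hcW => ?_⟩
  -- In the trivialization N ∩ U is a union of slices (M ∩ U) × {z}. If f vanishes on N near p, it
  -- vanishes on the slice through p near p, and the lift differentiates only along this slice.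
  · obtain ⟨P, e', -, he'⟩ := heN ⟨N, hN⟩ ⟨p.1, hp, p.2⟩
    let g : ((T.openPart M U).prod T'.differentialStructure).algebra :=
      ⟨(T.differentialStructure.restrictFun U f).1 ∘ e.symm,
        he.2.2 _ (T.differentialStructure.restrictFun U f).2⟩
    have h1 : (Y' (slice g (e p).2)).1 (e p).1 = (Y' 0).1 (e p).1 := by
      refine der_congr Y' (U := {a | (e.symm (a, (e p).2)).1 ∈ O})
        (hO.preimage (continuous_subtype_val.comp
          (e.symm.continuous.comp (Continuous.prodMk_left _)))) ?_ ?_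
      · change (e.symm (e p)).1 ∈ O
        rw [e.symm_apply_apply]
        exact hpO
      · intro a ha
        refine hf _ ?_ ha
        let w := e'.symm (a, (e' ⟨⟨p.1, hp⟩, p.2⟩).2)
        have hw : e ⟨w.1.1, w.2⟩ = (a, (e p).2) := by
          have h2 := he' w.1 w.2
          have h3 := he' ⟨p.1, hp⟩ p.2
          have h4 : e' ⟨w.1, w.2⟩ = (a, (e' ⟨⟨p.1, hp⟩, p.2⟩).2) := e'.apply_symm_apply _
          rw [h2, h4]
          exact congrArg (fun z : F => (a, z)) (congrArg Prod.snd h3).symm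
        rw [← hw, e.symm_apply_apply]
        exact w.1.2
    rw [map_zero] at h1
    exact h1
  -- M ∩ U is the slice over o, so the curve t ↦ (c' t, o) in the product is the original curve.
  · let c' : ℝ → {p : M.1 | p.1 ∈ U} := fun t =>
      if h : (c t).1 ∈ U then ⟨c t, h⟩ else ⟨x, hxU⟩
    have hc' : ∀ t ∈ I, (c' t).1 = c t := by
      intro t ht
      have h : (c t).1 ∈ U := hWU (hcW t ht)
      simp only [c', h, dif_pos]
    have h1 : IsIntegralCurveOn Y' c' I :=
      IsIntegralCurveOn.restrictDer hA (hc.congr hc')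
    have h2 : ∀ t ∈ I, (e.symm (c' t, o)).1 = (c t).1 := by
      intro t ht
      have h := heM (c' t).1 (c' t).2
      rw [show (c' t, o) = _ from h.symm, e.symm_apply_apply]
      exact congrArg Subtype.val (hc' t ht)
    have h3 := ((h1.prodDer (D' := T'.differentialStructure) o).pushforward he.symm).extendDer hβ
      fun t ht => by
        rw [h2 t ht]
        exact hβW _ (hcW t ht)
    exact h3.congr fun t ht => (h2 t ht).symm

/-! ### Orbits of the strongly stratified vector fields. -/

theorem eventually_flowsTo {T : SmoothStratification S} (hT : T.IsLocallyTrivial) {M : Set S}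
    (hM : M ∈ T.strata) {x : S} (hx : x ∈ M) :
    ∀ᶠ y in 𝓝[M] x, ∃ X ∈ T.stronglyStratified, FlowsTo X 1 x y := by
  -- G is chosen before the field on M, so the joining curves can be required to stay in G, where
  -- they lift.
  obtain ⟨G, hG, hlift⟩ := exists_lift hT ⟨M, hM⟩ ⟨x, hx⟩
  refine (eventually_nhds_subtype_iff M ⟨x, hx⟩
    fun y => ∃ X ∈ T.stronglyStratified, FlowsTo X 1 x y).1 ?_
  filter_upwards [(T.isSmoothManifold ⟨M, hM⟩).exists_integralCurve hG] with y hy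
  obtain ⟨Y, c, hc, hc0, hc1, hcG⟩ := hy
  obtain ⟨X, hX, hXc⟩ := hlift Y
  exact ⟨X, hX, Icc 0 1, _, ordConnected_Icc, ⟨le_rfl, zero_le_one⟩, ⟨zero_le_one, le_rfl⟩,
    hXc c _ hc hcG, by simp only [hc0], by simp only [hc1]⟩

/-- Nearby points of M are reached in time 1, so the orbit is open in M. Reversing time makes
reachability symmetric, so its complement in M is open too. -/
theorem orbit_eq {T : SmoothStratification S} (hT : T.IsLocallyTrivial) {M : Set S}
    (hM : M ∈ T.strata) (hconn : IsConnected M) {x : S} (hx : x ∈ M) :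
    orbit T.stronglyStratified x = M := by
  apply Subset.antisymm
  · intro y hy
    induction hy with
    | refl => exact hx
    | tail _ h ih =>
      obtain ⟨X, hX, t, ht⟩ := h
      exact T.flowsTo_mem hX ht hM ih
  · refine hconn.isPreconnected.forall_of_eventually
      (P := fun y => y ∈ orbit T.stronglyStratified x) hx Relation.ReflTransGen.refl ?_ ?_
    · intro y hy hyx
      filter_upwards [eventually_flowsTo hT hM hy] with z hz
      obtain ⟨X, hX, h⟩ := hz
      exact Relation.ReflTransGen.tail hyx ⟨X, hX, 1, h⟩
    · intro y hy hyx
      filter_upwards [eventually_flowsTo hT hM hy] with z hz hzx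
      obtain ⟨X, hX, h⟩ := hz
      exact hyx (Relation.ReflTransGen.tail hzx ⟨X, hX, -1, h.symm⟩)

end SmoothStratification

theorem theorem7 {S : Type u} [TopologicalSpace S] [T2Space S] [SecondCountableTopology S]
    [ParacompactSpace S] (T : SmoothStratification S)
    (hconn : ∀ M ∈ T.strata, IsConnected M) (htriv : T.IsLocallyTrivial) :
    IsLocallyComplete T.stronglyStratified ∧
      Set.range (orbit T.stronglyStratified) = T.strata := by
  refine ⟨SmoothStratification.isLocallyComplete htriv, ?_⟩
  ext M
  constructor
  · rintro ⟨x, rfl⟩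
    obtain ⟨M, ⟨hM, hx⟩, -⟩ := T.isPartition.2 x
    rwa [SmoothStratification.orbit_eq htriv hM (hconn M hM) hx]
  · intro hM
    obtain ⟨x, hx⟩ := (hconn M hM).nonempty
    exact ⟨x, SmoothStratification.orbit_eq htriv hM (hconn M hM) hx⟩
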